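/- Let $\mathbb A$ be a countably infinite set (of atoms) and $\mathbb A_\bot=\mathbb A\cup\{\bot\}$ with $\bot\notin\mathbb A$. A register automaton consists of a finite set $X$ of registers, a finite input alphabet $\Sigma$, a finite set $Q$ of control locations with sets $I,F\subseteq Q$ of initial and final locations, and a finite set of rules $(p,\sigma,\varphi,Y,q)$ with $p,q\in Q$, $\sigma\in\Sigma$, $Y\subseteq X$, and $\varphi$ a Boolean combination of formulas $u=v$ and $u=\bot$ with $u,v\in X\cup\{y\}$, where the variable $y\notin X$ denotes the input atom. A configuration is a pair $(p,\mu)$ with $p\in Q$ and $\mu\colon X\to\mathbb A_\bot$. When the letter $(\sigma,a)\in\Sigma\times\mathbb A$ is read, such a rule leads from $(p,\mu)$ to $(q,\mu')$ whenever $\varphi$ holds for $\mu$ and $y=a$, where $\mu'$ equals $a$ on $Y$ and $\mu$ on $X\setminus Y$. The automaton $A$ recognises the language $L(A)\subseteq(\Sigma\times\mathbb A)^*$ of all data words labelling a run that starts in a location of $I$ with all registers equal to $\bot$ and ends in a location of $F$. It is deterministic if $|I|=1$ and any two rules $(p,\sigma,\varphi,Y,q)$, $(p,\sigma,\varphi',Y',q')$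 for which $\varphi\wedge\varphi'$ is satisfied by some valuation $X\cup\{y\}\to\mathbb A_\bot$ have $Y=Y'$ and $q=q'$. **Theorem.** The following problem is undecidable: given a register automaton $A$ with one register, is there a deterministic register automaton $B$ (with any finite number of registers and any finite number of control locations) such that $L(A)=L(B)$? -/

import Mathlib

/-- Quantifier-free constraints over equality atoms, with variables from `V`. -/
inductive Constraint (V : Type) : Type where
  | tru : Constraint V
  | fls : Constraint V
  | eq (x y : V) : Constraint V
  | isBot (x : V) : Constraint V
  | neg (φ : Constraint V) : Constraint V
  | and (φ ψ : Constraint V) : Constraint V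
  | or (φ ψ : Constraint V) : Constraint V

namespace Constraint

/-- Satisfaction of a constraint by a valuation `ν : V → 𝔸 ∪ {⊥}`; the undefined value `⊥` is
`none`. -/
def Sat {V 𝔸 : Type} (ν : V → Option 𝔸) : Constraint V → Prop
  | tru => True
  | fls => False
  | eq x y => ν x = ν y
  | isBot x => ν x = none
  | neg φ => ¬ φ.Sat ν
  | and φ ψ => φ.Sat ν ∧ ψ.Sat ν
  | or φ ψ => φ.Sat ν ∨ ψ.Sat ν

/-- Gödel numbering of constraints. -/
def code {V : Type} [Encodable V] : Constraint V → ℕ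
  | tru => Nat.pair 0 0
  | fls => Nat.pair 1 0
  | eq x y => Nat.pair 2 (Nat.pair (Encodable.encode x) (Encodable.encode y))
  | isBot x => Nat.pair 3 (Encodable.encode x)
  | neg φ => Nat.pair 4 φ.code
  | and φ ψ => Nat.pair 5 (Nat.pair φ.code ψ.code)
  | or φ ψ => Nat.pair 6 (Nat.pair φ.code ψ.code)

theorem code_injective {V : Type} [Encodable V] :
    Function.Injective (code : Constraint V → ℕ) := by
  intro φ
  induction φ with
  | neg φ ih =>
    intro χ h
    cases χ <;> simp only [code, Nat.pair_eq_pair] at h <;> try omega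
    rw [ih h.2]
  | and φ ψ ih₁ ih₂ =>
    intro χ h
    cases χ <;> simp only [code, Nat.pair_eq_pair] at h <;> try omega
    rw [ih₁ h.2.1, ih₂ h.2.2]
  | or φ ψ ih₁ ih₂ =>
    intro χ h
    cases χ <;> simp only [code, Nat.pair_eq_pair] at h <;> try omega
    rw [ih₁ h.2.1, ih₂ h.2.2]
  | _ =>
    intro χ h
    cases χ <;> simp_all [code, Nat.pair_eq_pair]

end Constraint

/-- A transition rule `(src, sym, guard, Y, dst)` with registers `X`, input alphabet `S` and
control locations `Q`. The variables of the guard are the registers (`some x`) and the input data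
value (`none`). The set `Y ⊆ X` of registers that are updated to store the input data value is
given by its characteristic function `upd`. -/
structure TransitionRule (X S Q : Type) where
  src : Q
  sym : S
  guard : Constraint (Option X)
  upd : X → Bool
  dst : Q

/-- A (nondeterministic) register automaton, without guessing and without `ε`-transition rules,
with registers `X`, input alphabet `S` and control locations `Q` (to be instantiated with finite
types). The sets of initial locations, of final locations and of transition rules are finite and
are given as lists; order and multiplicity play no role. -/
structure RegisterAutomaton (X S Q : Type) where
  init : List Q
  final : List Q
  rules : List (TransitionRule X S Q)

namespace RegisterAutomaton

variable {X S Q : Type}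

/-- Transitions between configurations, labelled by an input symbol and an atom. -/
def Step {𝔸 : Type} (A : RegisterAutomaton X S Q) (c : Q × (X → Option 𝔸)) (b : S × 𝔸)
    (d : Q × (X → Option 𝔸)) : Prop :=
  ∃ r ∈ A.rules, r.src = c.1 ∧ r.sym = b.1 ∧
    r.guard.Sat (fun v : Option X => v.elim (some b.2) c.2) ∧
    d = (r.dst, fun x => if r.upd x then some b.2 else c.2 x)

/-- `A.Run c w d`: there is a run over the data word `w` from the configuration `c` to the
configuration `d`. -/
inductive Run {𝔸 : Type} (A : RegisterAutomaton X S Q) :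
    Q × (X → Option 𝔸) → List (S × 𝔸) → Q × (X → Option 𝔸) → Prop where
  | nil (c : Q × (X → Option 𝔸)) : Run A c [] c
  | cons {c d e : Q × (X → Option 𝔸)} {b : S × 𝔸} {w : List (S × 𝔸)} :
      A.Step c b d → Run A d w e → Run A c (b :: w) e

/-- The data language recognised by `A`: runs start in an initial location with all registers
undefined, and end in a final location. -/
def language (𝔸 : Type) (A : RegisterAutomaton X S Q) : Language (S × 𝔸) :=
  {w | ∃ p ∈ A.init, ∃ q ∈ A.final, ∃ μ : X → Option 𝔸, A.Run (p, fun _ => none) w (q, μ)}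

/-- `A` is deterministic: it has precisely one initial location, and two rules from the same
location over the same symbol, with jointly satisfiable guards, update the same registers and go
to the same location. -/
def IsDeterministic (𝔸 : Type) (A : RegisterAutomaton X S Q) : Prop :=
  (∃ p, ∀ q, q ∈ A.init ↔ q = p) ∧
  ∀ r ∈ A.rules, ∀ r' ∈ A.rules, r.src = r'.src → r.sym = r'.sym →
    (∃ ν : Option X → Option 𝔸, (r.guard.and r'.guard).Sat ν) →
    r.upd = r'.upd ∧ r.dst = r'.dst

/-- Gödel numbering of register automata with `k` registers, `m` input symbols and `n` control
locations. -/
def code {k m n : ℕ} (A : RegisterAutomaton (Fin k) (Fin m) (Fin n)) : ℕ :=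
  Encodable.encode (k, m, n, A.init.map Fin.val, A.final.map Fin.val,
    A.rules.map fun r => (r.src.val, r.sym.val, r.guard.code, List.ofFn r.upd, r.dst.val))

/-- The numbering is injective: a register automaton can be read off from its number. -/
theorem code_injective : Function.Injective
    (fun A : (Σ k m n : ℕ, RegisterAutomaton (Fin k) (Fin m) (Fin n)) => A.2.2.2.code) := by
  rintro ⟨k, m, n, A⟩ ⟨k', m', n', A'⟩ h
  have h := Encodable.encode_injective h
  simp only [Prod.mk.injEq] at h
  obtain ⟨rfl, rfl, rfl, h₁, h₂, h₃⟩ := h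
  obtain ⟨i, f, r⟩ := A
  obtain ⟨i', f', r'⟩ := A'
  have g₁ := List.map_injective_iff.2 Fin.val_injective h₁
  have g₂ := List.map_injective_iff.2 Fin.val_injective h₂
  have g₃ := List.map_injective_iff.2 (fun a b hab => by
    obtain ⟨s, y, g, u, d⟩ := a
    obtain ⟨s', y', g', u', d'⟩ := b
    simp only [Prod.mk.injEq] at hab
    obtain ⟨e₁, e₂, e₃, e₄, e₅⟩ := hab
    have e₁ := Fin.val_injective e₁
    have e₂ := Fin.val_injective e₂
    have e₃ := Constraint.code_injective e₃
    have e₄ := List.ofFn_injective e₄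
    have e₅ := Fin.val_injective e₅
    subst e₁ e₂ e₃ e₄ e₅
    rfl) h₃
  simp only at g₁ g₂ g₃
  subst g₁ g₂ g₃
  rfl

end RegisterAutomaton

/-- A data language over the alphabet `S` is a DRA language if it is recognised by a deterministic
register automaton, with any finite numbers of registers and of control locations. -/
def IsDRALanguage {S 𝔸 : Type} (L : Language (S × 𝔸)) : Prop :=
  ∃ (X Q : Type) (_ : Finite X) (_ : Finite Q) (B : RegisterAutomaton X S Q),
    B.IsDeterministic 𝔸 ∧ B.language 𝔸 = L

/-! The halting problem of a fixed counter machine `M` on inputs `n` is reduced to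
determinisability. The one-register automaton `errorAutomaton n` accepts the words that are not
correct encodings in the following sense: it guesses one violation and verifies it.

A word is divided into blocks. The atoms of a block are pairwise distinct and labelled as free,
wasted or belonging to a counter. From one block to the next, only the head of the block changes its
label, and atoms may be gained but not lost. A load or an increment turns a free atom into a counter
atom, a decrement wastes a counter atom, and any other step wastes a free atom. A reset is allowed
only if no atom is free; it drops its head, frees all other atoms and begins a new round, in which
`n` loads precede a run of `M`. The last block is empty, and only resets lose atoms.

Suppose that `M` halts after `j` steps. Then no block of a correct word has more than `j + n + 1`
atoms (`no_large_block`). Indeed, the last block exceeding the bound is a reset, and the next block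
consists of exactly `j + n + 1` free atoms. The blocks cannot shrink before the next reset and
cannot grow beyond the bound, so no atom is gained and the simulation is exact. It arrives at the
halting location with a free atom left, where neither a step nor a reset is possible. Hence, after a
prefix of a correct word, the register can only hold atoms of the last two blocks, and a subset
construction with boundedly many registers determinises the automaton (`isDRALanguage_of_bounded`).

Suppose that `M` does not halt. Then a round can be continued from any number of atoms until no atom
is free, and it ends with a reset that loses one atom. Repeating this leads to the empty block, so
correct words can begin with arbitrarily large blocks (`roundsComplete`). After such a block, nearly
all of its atoms have to be remembered, which no deterministic automaton can do
(`not_isDRALanguage_of_memory`).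

A machine with undecidable halting problem is obtained by compiling unbounded search for a zero of a
primitive recursive function (`exists_search`). The input `n` affects only the locations and rules
that count loads, so the code of the automaton is computable from `n`
(`computable_code_numberedAutomaton`). -/

theorem Constraint.sat_map {V 𝔸 𝔹 : Type} (f : 𝔸 → 𝔹) (ν : V → Option 𝔸)
    (hf : ∀ x y a b, ν x = some a → ν y = some b → f a = f b → a = b) (φ : Constraint V) :
    φ.Sat (fun v => (ν v).map f) ↔ φ.Sat ν := by
  induction φ with
  | tru => rfl
  | fls => rfl
  | eq x y =>
    simp only [Sat]
    refine ⟨fun h => ?_, fun h => by rw [h]⟩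
    rcases hx : ν x with _ | a <;> rcases hy : ν y with _ | b <;> simp [hx, hy] at h ⊢
    exact hf x y a b hx hy h
  | isBot x => simp [Sat]
  | neg φ ih => simp [Sat, ih]
  | and φ ψ ih₁ ih₂ => simp [Sat, ih₁, ih₂]
  | or φ ψ ih₁ ih₂ => simp [Sat, ih₁, ih₂]

/-! ### Runs and renaming of atoms -/

namespace RegisterAutomaton

section Basic

variable {X S Q 𝔸 : Type} {A : RegisterAutomaton X S Q}

/-- The automaton accepts a word from a given configuration. -/
def Accepts (A : RegisterAutomaton X S Q) (c : Q × (X → Option 𝔸)) (w : List (S × 𝔸)) : Prop :=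
  ∃ q ∈ A.final, ∃ μ, A.Run c w (q, μ)

theorem run_nil_iff {c d : Q × (X → Option 𝔸)} : A.Run c [] d ↔ d = c := by
  constructor
  · rintro ⟨⟩
    rfl
  · rintro rfl
    exact .nil _

theorem run_cons_iff {c e : Q × (X → Option 𝔸)} {b : S × 𝔸} {w : List (S × 𝔸)} :
    A.Run c (b :: w) e ↔ ∃ d, A.Step c b d ∧ A.Run d w e := by
  constructor
  · rintro (_ | ⟨h, h'⟩)
    exact ⟨_, h, h'⟩
  · rintro ⟨d, h, h'⟩
    exact .cons h h'

theorem run_append_iff {u v : List (S × 𝔸)} {c e : Q × (X → Option 𝔸)} :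
    A.Run c (u ++ v) e ↔ ∃ d, A.Run c u d ∧ A.Run d v e := by
  induction u generalizing c with
  | nil => simp [run_nil_iff]
  | cons b u ih =>
    simp only [List.cons_append, run_cons_iff, ih]
    constructor
    · rintro ⟨d, h, d', h', h''⟩
      exact ⟨d', ⟨d, h, h'⟩, h''⟩
    · rintro ⟨d', ⟨d, h, h'⟩, h''⟩
      exact ⟨d, h, d', h', h''⟩

theorem accepts_nil {c : Q × (X → Option 𝔸)} : A.Accepts c [] ↔ c.1 ∈ A.final := by
  simp only [Accepts, run_nil_iff]
  constructor
  · rintro ⟨q, hq, μ, rfl⟩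
    exact hq
  · intro h
    exact ⟨c.1, h, c.2, rfl⟩

theorem accepts_cons {c : Q × (X → Option 𝔸)} {b : S × 𝔸} {w : List (S × 𝔸)} :
    A.Accepts c (b :: w) ↔ ∃ d, A.Step c b d ∧ A.Accepts d w := by
  simp only [Accepts, run_cons_iff]
  constructor
  · rintro ⟨q, hq, μ, d, h, h'⟩
    exact ⟨d, h, q, hq, μ, h'⟩
  · rintro ⟨d, h, q, hq, μ, h'⟩
    exact ⟨q, hq, μ, d, h, h'⟩

theorem accepts_append {c : Q × (X → Option 𝔸)} {u v : List (S × 𝔸)} :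
    A.Accepts c (u ++ v) ↔ ∃ d, A.Run c u d ∧ A.Accepts d v := by
  simp only [Accepts, run_append_iff]
  constructor
  · rintro ⟨q, hq, μ, d, h, h'⟩
    exact ⟨d, h, q, hq, μ, h'⟩
  · rintro ⟨d, h, q, hq, μ, h'⟩
    exact ⟨q, hq, μ, d, h, h'⟩

theorem mem_language {w : List (S × 𝔸)} :
    w ∈ A.language 𝔸 ↔ ∃ p ∈ A.init, A.Accepts (p, fun _ => none) w :=
  Iff.rfl

/-- Renaming the atoms in a configuration. -/
def mapAtoms {𝔹 : Type} (f : 𝔸 → 𝔹) (c : Q × (X → Option 𝔸)) : Q × (X → Option 𝔹) :=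
  (c.1, fun x => (c.2 x).map f)

/-- A step only compares the input and the stored atoms with each other, so injectivity on these
suffices. The subset construction needs this local form, because there the renaming of indices to
atoms is injective on live indices only. -/
theorem step_mapAtoms {𝔹 : Type} {f : 𝔸 → 𝔹} {c : Q × (X → Option 𝔸)} {s : S} {a : 𝔸}
    (hf : Set.InjOn f {e | e = a ∨ ∃ x, c.2 x = some e}) {d : Q × (X → Option 𝔹)} :
    A.Step (mapAtoms f c) (s, f a) d ↔ ∃ d', A.Step c (s, a) d' ∧ d = mapAtoms f d' := by
  have key : ∀ φ : Constraint (Option X),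
      φ.Sat (fun v : Option X => v.elim (some (f a)) (mapAtoms f c).2) ↔
        φ.Sat (fun v : Option X => v.elim (some a) c.2) := by
    intro φ
    rw [← Constraint.sat_map f]
    · refine iff_of_eq (congrArg (fun ν => φ.Sat ν) ?_)
      funext v
      cases v <;> rfl
    · intro x y e e' hx hy h
      refine hf ?_ ?_ h
      · cases x with
        | none => exact .inl (Option.some.inj hx).symm
        | some x => exact .inr ⟨x, hx⟩
      · cases y with
        | none => exact .inl (Option.some.inj hy).symm
        | some y => exact .inr ⟨y, hy⟩
  have upd : ∀ r : TransitionRule X S Q,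
      ((r.dst, fun x => if r.upd x then some (f a) else (mapAtoms f c).2 x) :
        Q × (X → Option 𝔹)) = mapAtoms f (r.dst, fun x => if r.upd x then some a else c.2 x) := by
    intro r
    simp only [mapAtoms, Prod.mk.injEq, true_and]
    funext x
    split <;> rfl
  constructor
  · rintro ⟨r, hr, h₁, h₂, h₃, rfl⟩
    exact ⟨_, ⟨r, hr, h₁, h₂, (key _).1 h₃, rfl⟩, upd r⟩
  · rintro ⟨_, ⟨r, hr, h₁, h₂, h₃, rfl⟩, rfl⟩
    exact ⟨r, hr, h₁, h₂, (key _).2 h₃, (upd r).symm⟩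

theorem Accepts.mapAtoms {𝔹 : Type} {f : 𝔸 → 𝔹} (hf : Function.Injective f)
    {w : List (S × 𝔸)} {c : Q × (X → Option 𝔸)} (h : A.Accepts c w) :
    A.Accepts (mapAtoms f c) (w.map (Prod.map id f)) := by
  induction w generalizing c with
  | nil => exact accepts_nil.2 (accepts_nil.1 h : c.1 ∈ A.final)
  | cons b w ih =>
    obtain ⟨d, hd, hw⟩ := accepts_cons.1 h
    exact accepts_cons.2 ⟨_, (step_mapAtoms hf.injOn).2 ⟨d, hd, rfl⟩, ih hw⟩

end Basic

/-! ### Renaming of symbols and locations -/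

section Relabel

variable {X S Q S' Q' 𝔸 : Type}

/-- Renaming input symbols and control locations. -/
def relabel (f : S → S') (g : Q → Q') (A : RegisterAutomaton X S Q) :
    RegisterAutomaton X S' Q' where
  init := A.init.map g
  final := A.final.map g
  rules := A.rules.map fun r => ⟨g r.src, f r.sym, r.guard, r.upd, g r.dst⟩

variable {f : S → S'} {g : Q → Q'} {A : RegisterAutomaton X S Q}

theorem step_relabel (hf : f.Injective) (hg : g.Injective) {c : Q × (X → Option 𝔸)} {b : S × 𝔸}
    {d : Q' × (X → Option 𝔸)} :
    (A.relabel f g).Step (g c.1, c.2) (f b.1, b.2) d ↔ ∃ d', A.Step c b d' ∧ d = (g d'.1, d'.2) := by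
  constructor
  · rintro ⟨r, hr, h₁, h₂, h₃, rfl⟩
    obtain ⟨r, hr', rfl⟩ := List.mem_map.1 hr
    exact ⟨_, ⟨r, hr', hg h₁, hf h₂, h₃, rfl⟩, rfl⟩
  · rintro ⟨_, ⟨r, hr, h₁, h₂, h₃, rfl⟩, rfl⟩
    exact ⟨_, List.mem_map.2 ⟨r, hr, rfl⟩, congrArg g h₁, congrArg f h₂, h₃, rfl⟩

theorem accepts_relabel (hf : f.Injective) (hg : g.Injective) {w : List (S × 𝔸)}
    {c : Q × (X → Option 𝔸)} :
    (A.relabel f g).Accepts (g c.1, c.2) (w.map (Prod.map f id)) ↔ A.Accepts c w := by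
  induction w generalizing c with
  | nil => simp [accepts_nil, relabel, hg.eq_iff]
  | cons b w ih =>
    simp only [List.map_cons, accepts_cons]
    constructor
    · rintro ⟨d, hd, h⟩
      obtain ⟨d', hd', rfl⟩ := (step_relabel hf hg).1 hd
      exact ⟨d', hd', ih.1 h⟩
    · rintro ⟨d, hd, h⟩
      exact ⟨_, (step_relabel hf hg).2 ⟨d, hd, rfl⟩, ih.2 h⟩

theorem mem_language_relabel (hf : f.Injective) (hg : g.Injective) {w : List (S × 𝔸)} :
    w.map (Prod.map f id) ∈ (A.relabel f g).language 𝔸 ↔ w ∈ A.language 𝔸 := by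
  simp only [mem_language, relabel, List.mem_map]
  constructor
  · rintro ⟨_, ⟨p, hp, rfl⟩, h⟩
    exact ⟨p, hp, (accepts_relabel (c := (p, fun _ => none)) hf hg).1 h⟩
  · rintro ⟨p, hp, h⟩
    exact ⟨_, ⟨p, hp, rfl⟩, (accepts_relabel (c := (p, fun _ => none)) hf hg).2 h⟩

theorem IsDeterministic.relabel_symbols (hf : f.Injective) (h : A.IsDeterministic 𝔸) :
    (A.relabel f id).IsDeterministic 𝔸 := by
  refine ⟨by simpa [relabel] using h.1, ?_⟩
  intro r hr r' hr' h₁ h₂ h₃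
  obtain ⟨r, hm, rfl⟩ := List.mem_map.1 hr
  obtain ⟨r', hm', rfl⟩ := List.mem_map.1 hr'
  exact h.2 r hm r' hm' h₁ (hf h₂) h₃

end Relabel

theorem _root_.IsDRALanguage.of_relabel {S S' 𝔸 : Type} (e : S ≃ S') {L : Language (S × 𝔸)}
    {L' : Language (S' × 𝔸)} (hL : ∀ w, w.map (Prod.map e id) ∈ L' ↔ w ∈ L)
    (h : IsDRALanguage L) : IsDRALanguage L' := by
  obtain ⟨X, Q, hX, hQ, B, hB, rfl⟩ := h
  refine ⟨X, Q, hX, hQ, B.relabel e id, hB.relabel_symbols e.injective, ?_⟩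
  ext w
  have hw : w = (w.map (Prod.map e.symm id)).map (Prod.map e id) := by
    simp [List.map_map, Function.comp_def, Prod.map]
  rw [hw, mem_language_relabel e.injective Function.injective_id, hL]

/-! ### Lower bound for the memory of deterministic automata -/

section Deterministic

variable {X S Q 𝔸 : Type} {A : RegisterAutomaton X S Q}

theorem IsDeterministic.step_unique (h : A.IsDeterministic 𝔸) {c d d' : Q × (X → Option 𝔸)}
    {b : S × 𝔸} (hd : A.Step c b d) (hd' : A.Step c b d') : d = d' := by
  obtain ⟨r, hr, h₁, h₂, h₃, rfl⟩ := hd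
  obtain ⟨r', hr', h₁', h₂', h₃', rfl⟩ := hd'
  obtain ⟨hu, ht⟩ := h.2 r hr r' hr' (h₁.trans h₁'.symm) (h₂.trans h₂'.symm) ⟨_, h₃, h₃'⟩
  rw [hu, ht]

theorem IsDeterministic.run_unique (h : A.IsDeterministic 𝔸) {w : List (S × 𝔸)}
    {c d d' : Q × (X → Option 𝔸)} (hd : A.Run c w d) (hd' : A.Run c w d') : d = d' := by
  induction w generalizing c with
  | nil => rw [run_nil_iff.1 hd, run_nil_iff.1 hd']
  | cons b w ih =>
    obtain ⟨e, he, hd⟩ := run_cons_iff.1 hd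
    obtain ⟨e', he', hd'⟩ := run_cons_iff.1 hd'
    obtain rfl := h.step_unique he he'
    exact ih hd hd'

/-- A language is not deterministic if arbitrarily many atoms have to be remembered at once. -/
theorem _root_.not_isDRALanguage_of_memory [Infinite 𝔸] [DecidableEq 𝔸]
    {L : Language (S × 𝔸)}
    (h : ∀ k : ℕ, ∃ (u v : List (S × 𝔸)) (F G : Finset 𝔸), k < F.card ∧ u ++ v ∉ L ∧
      ∀ a ∈ F, ∀ b ∉ G, 
        u ++ v.map (Prod.map id (Equiv.swap a b)) ∈ L) :
    ¬ IsDRALanguage L := by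
  classical
  rintro ⟨X, Q, hX, hQ, B, hB, rfl⟩
  have := Fintype.ofFinite X
  obtain ⟨u, v, F, G, hF, huv, hswap⟩ := h (Fintype.card X)
  obtain ⟨p₀, hp₀⟩ := hB.1
  obtain ⟨a₀, ha₀⟩ := Finset.card_pos.1 (Nat.zero_lt_of_lt hF)
  obtain ⟨b₀, hb₀⟩ := Infinite.exists_notMem_finset G
  -- This instance only serves to show that a run over `u` exists; by determinism its last
  -- configuration is the same for all swaps.
  obtain ⟨p, hp, hacc⟩ := hswap a₀ ha₀ b₀ hb₀
  obtain rfl := (hp₀ p).1 hp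
  obtain ⟨⟨q, μ⟩, hu, -⟩ := accepts_append.1 hacc
  -- Undefined registers contribute the default `a₀`, which may exclude `a₀` needlessly but does not
  -- affect the bound on the cardinality.
  have hcard : (Finset.univ.image fun x => (μ x).getD a₀).card < F.card :=
    (Finset.card_image_le).trans_lt hF
  obtain ⟨a, ha, haμ⟩ := Finset.exists_mem_notMem_of_card_lt_card hcard
  obtain ⟨b, hb⟩ := Infinite.exists_notMem_finset (G ∪ Finset.univ.image fun x => (μ x).getD a₀)
  simp only [Finset.mem_union, not_or] at hb
  obtain ⟨p', hp', hacc'⟩ := hswap a ha b hb.1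
  obtain rfl := (hp₀ p').1 hp'
  obtain ⟨d, hd, hv⟩ := accepts_append.1 hacc'
  obtain rfl := hB.run_unique hu hd
  -- Neither `a` nor `b` is stored after `u`, so swapping them fixes the configuration and turns the
  -- swapped continuation back into `v`, which would then be accepted.
  have hv' := hv.mapAtoms (Equiv.swap a b).injective
  refine huv ⟨p', hp', accepts_append.2 ⟨_, hu, ?_⟩⟩
  convert hv' using 1
  · simp only [mapAtoms, Prod.mk.injEq, true_and]
    funext x
    rcases hx : μ x with _ | e
    · rfl
    · simp only [Option.map_some, Option.some.injEq]
      have hmem : e ∈ Finset.univ.image fun x => (μ x).getD a₀ :=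
        Finset.mem_image.2 ⟨x, Finset.mem_univ _, by simp [hx]⟩
      rw [Equiv.swap_apply_of_ne_of_ne]
      · rintro rfl
        exact haμ hmem
      · rintro rfl
        exact hb.2 hmem
  · simp [List.map_map, Function.comp_def, Prod.map]

end Deterministic

end RegisterAutomaton

/-! ### Determinisation by a subset construction with finitely many registers -/

namespace RegisterAutomaton

section Determinisation

variable {X S Q 𝔸 : Type}

/-- The guard specifying which registers contain the input atom. -/
noncomputable def patternGuard [Fintype X] (π : X → Bool) : Constraint (Option X) :=
  (Finset.univ.toList : List X).foldr (fun x φ => Constraint.and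
    (if π x then Constraint.eq none (some x) else (Constraint.eq none (some x)).neg) φ)
    Constraint.tru

theorem sat_patternGuard [Fintype X] {π : X → Bool} {ν : Option X → Option 𝔸} :
    (patternGuard π).Sat ν ↔ ∀ x, π x = true ↔ ν none = ν (some x) := by
  have key : ∀ l : List X, (l.foldr (fun x φ => Constraint.and
      (if π x then Constraint.eq none (some x) else (Constraint.eq none (some x)).neg) φ)
      Constraint.tru).Sat ν ↔ ∀ x ∈ l, π x = true ↔ ν none = ν (some x) := by
    intro l
    induction l with
    | nil => simp [Constraint.Sat]
    | cons x l ih =>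
      simp only [List.foldr_cons, Constraint.Sat, ih, List.forall_mem_cons]
      refine and_congr_left fun _ => ?_
      cases π x <;> simp [Constraint.Sat]
  rw [patternGuard, key]
  simp

/-- The deterministic register automaton with a given transition function. -/
noncomputable def ofFunction [Fintype X] [Fintype S] [Fintype Q] (q₀ : Q) (F : Set Q)
    (δ : Q → S → (X → Bool) → (X → Bool) × Q) : RegisterAutomaton X S Q := by
  classical
  exact
  { init := [q₀]
    final := (Finset.univ.filter (· ∈ F)).toList
    rules := (Finset.univ.toList : List (Q × S × (X → Bool))).map fun t =>
      ⟨t.1, t.2.1, patternGuard t.2.2, (δ t.1 t.2.1 t.2.2).1, (δ t.1 t.2.1 t.2.2).2⟩ }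

variable [Fintype X] [Fintype S] [Fintype Q] {q₀ : Q} {F : Set Q}
  {δ : Q → S → (X → Bool) → (X → Bool) × Q}

/-- Guards for different patterns are mutually exclusive, so jointly satisfiable rules from the same
location over the same symbol coincide. -/
theorem isDeterministic_ofFunction : (ofFunction q₀ F δ).IsDeterministic 𝔸 := by
  classical
  refine ⟨⟨q₀, by simp [ofFunction]⟩, ?_⟩
  intro r hr r' hr' h₁ h₂ h₃
  obtain ⟨⟨p, s, π⟩, -, rfl⟩ := List.mem_map.1 hr
  obtain ⟨⟨p', s', π'⟩, -, rfl⟩ := List.mem_map.1 hr'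
  obtain rfl : p = p' := h₁
  obtain rfl : s = s' := h₂
  obtain ⟨ν, h, h'⟩ := h₃
  obtain rfl : π = π' := by
    funext x
    rw [Bool.eq_iff_iff, sat_patternGuard.1 h x, sat_patternGuard.1 h' x]
  exact ⟨rfl, rfl⟩

theorem step_ofFunction [DecidableEq 𝔸] {c d : Q × (X → Option 𝔸)} {s : S} {a : 𝔸} :
    (ofFunction q₀ F δ).Step c (s, a) d ↔
      d = ((δ c.1 s fun x => decide (some a = c.2 x)).2,
        fun x => if (δ c.1 s fun x => decide (some a = c.2 x)).1 x then some a else c.2 x) := by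
  constructor
  · rintro ⟨r, hr, h₁, h₂, h₃, rfl⟩
    obtain ⟨⟨p, s', π⟩, -, rfl⟩ := List.mem_map.1 hr
    obtain rfl : p = c.1 := h₁
    obtain rfl : s' = s := h₂
    obtain rfl : π = fun x => decide (some a = c.2 x) := by
      funext x
      rw [Bool.eq_iff_iff, sat_patternGuard.1 h₃ x]
      simp
    rfl
  · rintro rfl
    refine ⟨_, List.mem_map.2 ⟨(c.1, s, fun x => decide (some a = c.2 x)), by simp, rfl⟩,
      rfl, rfl, ?_, rfl⟩
    rw [sat_patternGuard]
    simp

theorem mem_final_ofFunction {q : Q} : q ∈ (ofFunction q₀ F δ).final ↔ q ∈ F := by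
  classical
  simp [ofFunction]

end Determinisation

section SubsetConstruction

variable {X S Q : Type} (A : RegisterAutomaton X S Q) {k : ℕ}

/-- An index is live in a set of symbolic configurations if it occurs in one of them. -/
def Live {I : Type} (T : Set (Q × (X → Option I))) (i : I) : Prop :=
  ∃ c ∈ T, ∃ x, c.2 x = some i

open Classical in
/-- The live register containing the input, if any. -/
noncomputable def inputIndex (T : Set (Q × (X → Option (Fin k)))) (π : Fin k → Bool) :
    Option (Fin k) :=
  if h : ∃ i, Live T i ∧ π i = true then some h.choose else none

/-- The symbolic successors; the index `none` stands for an input that is in no live register. -/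
def symbolicPost (T : Set (Q × (X → Option (Fin k)))) (s : S) (y : Option (Fin k)) :
    Set (Q × (X → Option (Option (Fin k)))) :=
  {d | ∃ c ∈ T, A.Step (mapAtoms some c) (s, y) d}

open Classical in
/-- The transition function of the subset construction; on overflow, the automaton goes to the
location `none`. -/
noncomputable def subsetStep (l : Option (Set (Q × (X → Option (Fin k))))) (s : S)
    (π : Fin k → Bool) : (Fin k → Bool) × Option (Set (Q × (X → Option (Fin k)))) :=
  match l with
  | none => (fun _ => false, none)
  | some T =>
    if h : ∃ j, ¬ Live (symbolicPost A T s (inputIndex T π)) (some j) then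
      (fun i => decide (i = h.choose),
        some (mapAtoms (fun o => o.getD h.choose) '' symbolicPost A T s (inputIndex T π)))
    else (fun _ => false, none)

variable {A} {𝔸 : Type}

/-- The configurations reachable by reading a word. -/
def reach (A : RegisterAutomaton X S Q) (w : List (S × 𝔸)) : Set (Q × (X → Option 𝔸)) :=
  {d | ∃ p ∈ A.init, A.Run (p, fun _ => none) w d}

theorem mem_reach_snoc {w : List (S × 𝔸)} {b : S × 𝔸} {d : Q × (X → Option 𝔸)} :
    d ∈ A.reach (w ++ [b]) ↔ ∃ c ∈ A.reach w, A.Step c b d := by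
  simp only [reach, Set.mem_ofPred_eq, run_append_iff, run_cons_iff, run_nil_iff]
  constructor
  · rintro ⟨p, hp, c, hc, d', hd, rfl⟩
    exact ⟨c, ⟨p, hp, hc⟩, hd⟩
  · rintro ⟨c, ⟨p, hp, hc⟩, hd⟩
    exact ⟨p, hp, c, hc, d, hd, rfl⟩

/-- The set `R` of configurations is represented by symbolic configurations and registers. -/
def Represents (T : Set (Q × (X → Option (Fin k)))) (μ : Fin k → Option 𝔸)
    (R : Set (Q × (X → Option 𝔸))) : Prop :=
  ∀ a : 𝔸, (∀ i, Live T i → μ i = some ((μ i).getD a)) ∧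
    Set.InjOn (fun i => (μ i).getD a) {i | Live T i} ∧
    R = mapAtoms (fun i => (μ i).getD a) '' T

theorem mapAtoms_congr {I J : Type} {f g : I → J} {c : Q × (X → Option I)}
    (h : ∀ x i, c.2 x = some i → f i = g i) : mapAtoms f c = mapAtoms g c := by
  simp only [mapAtoms, Prod.mk.injEq, true_and]
  funext x
  rcases hx : c.2 x with _ | i
  · rfl
  · simp [h x i hx]

theorem mapAtoms_comp {I J K : Type} (f : J → K) (g : I → J) (c : Q × (X → Option I)) :
    mapAtoms f (mapAtoms g c) = mapAtoms (f ∘ g) c := by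
  simp only [mapAtoms, Prod.mk.injEq, true_and]
  funext x
  simp

/-- The successors of represented configurations are represented by the symbolic successors. -/
theorem Represents.post {T : Set (Q × (X → Option (Fin k)))} {μ : Fin k → Option 𝔸}
    [DecidableEq 𝔸] {w : List (S × 𝔸)} (h : Represents T μ (A.reach w)) (s : S) (a : 𝔸)
    {P : Set (Q × (X → Option (Option (Fin k))))}
    (hP : P = symbolicPost A T s (inputIndex T fun i => decide (some a = μ i))) :
    (∀ i, Live P (some i) → μ i = some ((μ i).getD a)) ∧
      Set.InjOn (fun o : Option (Fin k) => o.elim a fun i => (μ i).getD a) {o | Live P o} ∧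
      A.reach (w ++ [(s, a)]) =
        mapAtoms (fun o : Option (Fin k) => o.elim a fun i => (μ i).getD a) '' P := by
  obtain ⟨h₁, h₂, h₃⟩ := h a
  set f : Option (Fin k) → 𝔸 := fun o => o.elim a fun i => (μ i).getD a with hf
  set y := inputIndex T fun i => decide (some a = μ i) with hy
  have hfy : f y = a ∧ ∀ i, y = some i → Live T i := by
    rw [hy, inputIndex]
    split_ifs with hi
    · have := hi.choose_spec
      refine ⟨?_, fun i hi' => Option.some.inj hi' ▸ this.1⟩
      have h' : some a = μ hi.choose := by simpa using this.2
      simp only [hf, Option.elim_some]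
      rw [← h', Option.getD_some]
    · exact ⟨rfl, by simp⟩
  have hynone : y = none → ∀ i, Live T i → f (some i) ≠ a := by
    intro hn i hi hia
    rw [hy, inputIndex] at hn
    split_ifs at hn with h'
    refine h' ⟨i, hi, ?_⟩
    have := h₁ i hi
    simp only [hf, Option.elim_some] at hia
    rw [hia] at this
    simp [this]
  -- Adding the index of the input keeps `f` injective: either it is a live index itself, or no live
  -- register contains `a`.
  have hinj : Set.InjOn f {o | o = y ∨ ∃ i, Live T i ∧ o = some i} := by
    have aux : ∀ i j, Live T i → Live T j → f (some i) = f (some j) → some i = some j :=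
      fun i j hi hj hij => congrArg some (h₂ hi hj hij)
    have aux' : ∀ i, Live T i → f y = f (some i) → y = some i := by
      intro i hi hij
      rcases hyy : y with _ | j
      · exact absurd (hij.symm.trans hfy.1) (hynone hyy i hi)
      · rw [hyy] at hij
        exact aux j i (hfy.2 j hyy) hi hij
    rintro o (rfl | ⟨i, hi, rfl⟩) o' (rfl | ⟨j, hj, rfl⟩) hoo
    · rfl
    · exact aux' j hj hoo
    · exact (aux' i hi hoo.symm).symm
    · exact aux i j hi hj hoo
  have hlive : ∀ o, Live P o → o = y ∨ ∃ i, Live T i ∧ o = some i := by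
    rintro o ⟨d, hd, x, hx⟩
    rw [hP] at hd
    obtain ⟨c, hc, r, hr, -, -, -, rfl⟩ := hd
    dsimp only at hx
    split_ifs at hx with hu
    · exact .inl (Option.some.inj hx).symm
    · simp only [mapAtoms, Option.map_eq_some_iff] at hx
      obtain ⟨i, hi, rfl⟩ := hx
      exact .inr ⟨i, ⟨c, hc, x, hi⟩, rfl⟩
  refine ⟨?_, hinj.mono hlive, ?_⟩
  · intro i hi
    rcases hlive _ hi with hi | ⟨j, hj, hij⟩
    · exact h₁ i (hfy.2 i hi.symm)
    · exact Option.some.inj hij ▸ h₁ j hj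
  · have hmap : ∀ c : Q × (X → Option (Fin k)),
        mapAtoms (fun i => (μ i).getD a) c = mapAtoms f (mapAtoms some c) :=
      fun c => (mapAtoms_comp f some c).symm
    have hstep : ∀ c ∈ T, ∀ d, A.Step (mapAtoms f (mapAtoms some c)) (s, a) d ↔
        ∃ d', A.Step (mapAtoms some c) (s, y) d' ∧ d = mapAtoms f d' := by
      intro c hc d
      conv_lhs => rw [← hfy.1]
      refine step_mapAtoms (hinj.mono ?_)
      rintro o (rfl | ⟨x, hx⟩)
      · exact .inl rfl
      · simp only [mapAtoms, Option.map_eq_some_iff] at hx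
        obtain ⟨i, hi, rfl⟩ := hx
        exact .inr ⟨i, ⟨c, hc, x, hi⟩, rfl⟩
    ext d
    rw [mem_reach_snoc, h₃, hP]
    constructor
    · rintro ⟨_, ⟨c, hc, rfl⟩, hd⟩
      rw [hmap, hstep c hc] at hd
      obtain ⟨d', hd', rfl⟩ := hd
      exact ⟨d', ⟨c, hc, hd'⟩, rfl⟩
    · rintro ⟨d', ⟨c, hc, hd'⟩, rfl⟩
      exact ⟨_, ⟨c, hc, rfl⟩, by rw [hmap, hstep c hc]; exact ⟨d', hd', rfl⟩⟩

/-- Correctness of a location and register valuation of the subset construction. -/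
def SubsetInvariant (A : RegisterAutomaton X S Q) (w : List (S × 𝔸))
    (c : Option (Set (Q × (X → Option (Fin k)))) × (Fin k → Option 𝔸)) : Prop :=
  match c.1 with
  | none => ∀ v, w ++ v ∈ A.language 𝔸
  | some T => Represents T c.2 (A.reach w)

/-- The symbolic successors use the `k` register indices and possibly `none` for a fresh input. If
some index is not live among them, its register is overwritten by the input and takes over the role
of `none`. If all are live, then `k` distinct atoms occur in reachable configurations; by `hK` this
happens only if all continuations are accepted, and then the overflow location is correct. -/
theorem SubsetInvariant.step [DecidableEq 𝔸] {w : List (S × 𝔸)} {s : S} {a : 𝔸}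
    {c : Option (Set (Q × (X → Option (Fin k)))) × (Fin k → Option 𝔸)}
    (hK : (∀ v, w ++ [(s, a)] ++ v ∈ A.language 𝔸) ∨ ∃ G : Finset 𝔸, G.card < k ∧
      ∀ d ∈ A.reach (w ++ [(s, a)]), ∀ x e, d.2 x = some e → e ∈ G)
    (h : SubsetInvariant A w c) :
    SubsetInvariant A (w ++ [(s, a)])
      ((subsetStep A c.1 s fun i => decide (some a = c.2 i)).2,
        fun i => if (subsetStep A c.1 s fun i => decide (some a = c.2 i)).1 i then some a
          else c.2 i) := by
  obtain ⟨l, μ⟩ := c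
  rcases l with _ | T
  · intro v
    rw [List.append_assoc]
    exact h _
  · set P := symbolicPost A T s (inputIndex T fun i => decide (some a = μ i)) with hP
    obtain ⟨h₁, h₂, h₃⟩ := Represents.post (h : Represents T μ (A.reach w)) s a hP
    set f : Option (Fin k) → 𝔸 := fun o => o.elim a fun i => (μ i).getD a with hf
    by_cases hj : ∃ j, ¬ Live P (some j)
    · have hst : subsetStep A (some T) s (fun i => decide (some a = μ i)) =
          (fun i => decide (i = hj.choose), some (mapAtoms (fun o => o.getD hj.choose) '' P)) :=
        dif_pos hj
      simp only [hst]
      set j := hj.choose with hjj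
      have hj' : ¬ Live P (some j) := hj.choose_spec
      intro b
      dsimp only
      have key : ∀ o, Live P o → (if decide (o.getD j = j) = true then some a else μ (o.getD j))
          = some (f o) := by
        intro o ho
        rcases o with _ | i
        · simp [hf]
        · have hij : i ≠ j := by
            rintro rfl
            exact hj' ho
          simp only [Option.getD_some, hij, decide_false, Bool.false_eq_true, if_false, hf,
            Option.elim_some]
          exact h₁ i ho
      have hlive : ∀ i, Live (mapAtoms (fun o => o.getD j) '' P) i → ∃ o, Live P o ∧ i = o.getD j := by
        rintro i ⟨_, ⟨d, hd, rfl⟩, x, hx⟩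
        simp only [mapAtoms, Option.map_eq_some_iff] at hx
        obtain ⟨o, ho, rfl⟩ := hx
        exact ⟨o, ⟨d, hd, x, ho⟩, rfl⟩
      refine ⟨?_, ?_, ?_⟩
      · intro i hi
        obtain ⟨o, ho, rfl⟩ := hlive i hi
        rw [key o ho]
        rfl
      · intro i hi i' hi' hii
        obtain ⟨o, ho, rfl⟩ := hlive i hi
        obtain ⟨o', ho', rfl⟩ := hlive i' hi'
        simp only [key o ho, key o' ho', Option.getD_some] at hii
        rw [h₂ ho ho' hii]
      · rw [h₃, Set.image_image]
        refine Set.image_congr fun d hd => ?_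
        rw [mapAtoms_comp]
        refine mapAtoms_congr fun x o ho => ?_
        simp only [Function.comp_apply, key o ⟨d, hd, x, ho⟩, Option.getD_some]
    · have hst : subsetStep A (some T) s (fun i => decide (some a = μ i)) =
          (fun _ => false, none) := dif_neg hj
      simp only [hst]
      push Not at hj
      rcases hK with hK | ⟨G, hG, hd⟩
      · exact hK
      · exfalso
        -- The live indices stand for distinct atoms, all of which lie in `G`.
        have hsub : (Finset.univ.image fun i : Fin k => f (some i)) ⊆ G := by
          intro e he
          obtain ⟨i, -, rfl⟩ := Finset.mem_image.1 he
          obtain ⟨d, hdP, x, hx⟩ := hj i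
          refine hd (mapAtoms f d) (h₃ ▸ ⟨d, hdP, rfl⟩) x _ ?_
          simp [mapAtoms, hx]
        have hcard : (Finset.univ.image fun i : Fin k => f (some i)).card = k := by
          rw [Finset.card_image_of_injective, Finset.card_univ, Fintype.card_fin]
          intro i i' hii
          exact Option.some.inj (h₂ (hj i) (hj i') hii)
        have := Finset.card_le_card hsub
        omega

/-- A register automaton can be determinised if, after every prefix that can be continued outside
of its language, its reachable configurations contain a bounded number of atoms. -/
theorem isDRALanguage_of_bounded [Finite X] [Finite S] [Finite Q]
    [Nonempty 𝔸] (K : ℕ)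
    (hK : ∀ u : List (S × 𝔸), (∀ v, u ++ v ∈ A.language 𝔸) ∨ ∃ G : Finset 𝔸, G.card ≤ K ∧
      ∀ d ∈ A.reach u, ∀ x e, d.2 x = some e → e ∈ G) :
    IsDRALanguage (A.language 𝔸) := by
  classical
  have := Fintype.ofFinite S
  have := Fintype.ofFinite (Option (Set (Q × (X → Option (Fin (K + 1))))))
  -- With at most `K` atoms to store, one of `K + 1` registers is always available for the next
  -- input.
  let q₀ : Option (Set (Q × (X → Option (Fin (K + 1))))) :=
    some {c | c.1 ∈ A.init ∧ c.2 = fun _ => none}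
  -- The overflow location `none` is final, since the condition is vacuous for it.
  let F : Set (Option (Set (Q × (X → Option (Fin (K + 1)))))) :=
    {l | ∀ T, l = some T → ∃ c ∈ T, c.1 ∈ A.final}
  let B := ofFunction q₀ F (subsetStep A)
  have hB : ∀ (v u : List (S × 𝔸)) (c), SubsetInvariant A u c →
      (B.Accepts c v ↔ u ++ v ∈ A.language 𝔸) := by
    intro v
    induction v with
    | nil =>
      rintro u ⟨l, μ⟩ hc
      rw [accepts_nil, mem_final_ofFunction, List.append_nil]
      rcases l with _ | T
      · have : u ∈ A.language 𝔸 := by simpa using hc []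
        simp [F, this]
      · have hu : u ∈ A.language 𝔸 ↔ ∃ d ∈ A.reach u, d.1 ∈ A.final := by
          constructor
          · rintro ⟨p, hp, q, hq, μ, h⟩
            exact ⟨(q, μ), ⟨p, hp, h⟩, hq⟩
          · rintro ⟨⟨q, μ⟩, ⟨p, hp, h⟩, hq⟩
            exact ⟨p, hp, q, hq, μ, h⟩
        rw [hu]
        rw [(hc (Classical.arbitrary 𝔸)).2.2]
        simp [F, mapAtoms]
    | cons b v ih =>
      intro u c hc
      obtain ⟨s, a⟩ := b
      have hst := hc.step (s := s) (a := a) (by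
        rcases hK (u ++ [(s, a)]) with h | ⟨G, hG, h⟩
        · exact .inl h
        · exact .inr ⟨G, Nat.lt_succ_of_le hG, h⟩)
      rw [accepts_cons]
      have : u ++ (s, a) :: v = u ++ [(s, a)] ++ v := by simp
      rw [this, ← ih _ _ hst]
      constructor
      · rintro ⟨d, hd, h⟩
        rw [step_ofFunction] at hd
        exact hd ▸ h
      · intro h
        exact ⟨_, step_ofFunction.2 rfl, h⟩
  refine ⟨Fin (K + 1), _, inferInstance, inferInstance, B, isDeterministic_ofFunction, ?_⟩
  ext w
  have h₀ : SubsetInvariant A ([] : List (S × 𝔸)) (q₀, fun _ => none) := by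
    have hl : ∀ i, ¬ Live {c : Q × (X → Option (Fin (K + 1))) | c.1 ∈ A.init ∧
        c.2 = fun _ => none} i := by
      rintro i ⟨⟨q, μ⟩, ⟨-, hc⟩, x, hx⟩
      simp only at hc hx
      simp [hc] at hx
    intro a
    refine ⟨fun i hi => absurd hi (hl i), fun i hi => absurd hi (hl i), ?_⟩
    ext ⟨q, μ⟩
    simp only [reach, run_nil_iff, Set.mem_ofPred_eq, Set.mem_image, mapAtoms, Prod.mk.injEq,
      Prod.exists]
    constructor
    · rintro ⟨p, hp, rfl, rfl⟩
      exact ⟨q, fun _ => none, ⟨hp, rfl⟩, rfl, rfl⟩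
    · rintro ⟨q', μ', ⟨hp, rfl⟩, rfl, rfl⟩
      exact ⟨q', hp, rfl, rfl⟩
  rw [← List.nil_append w, ← hB w [] _ h₀, List.nil_append, mem_language]
  simp [B, ofFunction]

end SubsetConstruction

end RegisterAutomaton

/-! ### Counter machines -/

/-- Instructions of a counter machine with control locations `Λ` and counters `C`. The instruction
`dec c q r` goes to `q` if `c` is zero; otherwise it decrements `c` and goes to `r`. -/
inductive CounterInstruction (Λ C : Type) : Type where
  | halt : CounterInstruction Λ C
  | nop (q : Λ) : CounterInstruction Λ C
  | inc (c : C) (q : Λ) : CounterInstruction Λ C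
  | dec (c : C) (q r : Λ) : CounterInstruction Λ C

namespace CounterInstruction

variable {Λ C : Type}

/-- The effect of an instruction on the counters, together with the next location. -/
def exec [DecidableEq C] (σ : C → ℕ) : CounterInstruction Λ C → Option (Λ × (C → ℕ))
  | halt => none
  | nop q => some (q, σ)
  | inc c q => some (q, Function.update σ c (σ c + 1))
  | dec c q r => some (if σ c = 0 then (q, σ) else (r, Function.update σ c (σ c - 1)))

end CounterInstruction

/-- `HaltsIn M j c`: the machine with program `M` halts after `j` steps from the configuration
`c`. -/
inductive HaltsIn {Λ C : Type} [DecidableEq C] (M : Λ → CounterInstruction Λ C) :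
    ℕ → Λ × (C → ℕ) → Prop where
  | halt {c : Λ × (C → ℕ)} : (M c.1).exec c.2 = none → HaltsIn M 0 c
  | step {c d : Λ × (C → ℕ)} {j : ℕ} : (M c.1).exec c.2 = some d → HaltsIn M j d →
      HaltsIn M (j + 1) c

namespace CounterMachine

variable {Λ C : Type} [DecidableEq C] {M : Λ → CounterInstruction Λ C}

/-- One step of a counter machine. -/
def Next (M : Λ → CounterInstruction Λ C) (c d : Λ × (C → ℕ)) : Prop :=
  (M c.1).exec c.2 = some d

theorem haltsIn_of_next {c d : Λ × (C → ℕ)} (h : Next M c d) {j : ℕ} (hj : HaltsIn M j c) :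
    ∃ i < j, HaltsIn M i d := by
  cases hj with
  | halt h' => rw [Next, h'] at h; cases h
  | step h' hd =>
    rw [Next, h'] at h
    exact ⟨_, Nat.lt_succ_self _, Option.some.inj h ▸ hd⟩

/-- The number of remaining steps strictly decreases along a computation; this is what excludes
halting of a search that never succeeds. -/
theorem haltsIn_of_transGen {c d : Λ × (C → ℕ)} (h : Relation.TransGen (Next M) c d) {j : ℕ}
    (hj : HaltsIn M j c) : ∃ i < j, HaltsIn M i d := by
  induction h with
  | single h => exact haltsIn_of_next h hj
  | tail _ h ih =>
    obtain ⟨i, hi, h'⟩ := ih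
    obtain ⟨i', hi', h''⟩ := haltsIn_of_next h h'
    exact ⟨i', hi'.trans hi, h''⟩

theorem exists_haltsIn_iff {c d : Λ × (C → ℕ)} (h : Relation.ReflTransGen (Next M) c d) :
    (∃ j, HaltsIn M j c) ↔ ∃ j, HaltsIn M j d := by
  induction h with
  | refl => rfl
  | tail _ h ih =>
    rw [ih]
    constructor
    · rintro ⟨j, hj⟩
      obtain ⟨i, -, hi⟩ := haltsIn_of_next h hj
      exact ⟨i, hi⟩
    · rintro ⟨j, hj⟩
      exact ⟨j + 1, .step h hj⟩

/-- A machine can be restricted to finitely many locations and counters if these are closed under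
its instructions. -/
theorem exists_restrict (M : Λ → CounterInstruction Λ C) {F : Set Λ} (hF : F.Finite)
    (hclosed : ∀ q ∈ F, ∀ (σ : C → ℕ) (d), (M q).exec σ = some d → d.1 ∈ F) {q₀ : Λ}
    (hq₀ : q₀ ∈ F) (c₀ : C) :
    ∃ (Λ' C' : Type) (_ : Finite Λ') (_ : Finite C') (_ : DecidableEq C')
      (M' : Λ' → CounterInstruction Λ' C') (q₀' : Λ') (c₀' : C'), ∀ n j,
      HaltsIn M' j (q₀', Function.update 0 c₀' n) ↔ HaltsIn M j (q₀, Function.update 0 c₀ n) := by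
  classical
  let G : Set C := insert c₀ (⋃ q ∈ F, {c | (∃ p, M q = .inc c p) ∨ ∃ p r, M q = .dec c p r})
  have hG : G.Finite := by
    refine Set.Finite.insert _ (hF.biUnion fun q _ => Set.Subsingleton.finite ?_)
    rintro c (⟨p, h⟩ | ⟨p, r, h⟩) c' (⟨p', h'⟩ | ⟨p', r', h'⟩) <;> rw [h] at h' <;> cases h' <;> rfl
  have hGF : ∀ q ∈ F, ∀ c, (∃ p, M q = .inc c p) ∨ (∃ p r, M q = .dec c p r) → c ∈ G :=
    fun q hq c h => .inr (Set.mem_biUnion hq h)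
  have key : ∀ q : F, ∃ I : CounterInstruction F G, ∀ σ : C → ℕ,
      (M q).exec σ = none ∧ I.exec (fun c : G => σ c) = none ∨ ∃ (p : F) (τ : C → ℕ),
        (M q).exec σ = some (↑p, τ) ∧ I.exec (fun c : G => σ c) = some (p, fun c : G => τ c) := by
    rintro ⟨q, hq⟩
    have hcl := hclosed q hq
    have hg := hGF q hq
    have hupd : ∀ (c : C) (hc : c ∈ G) (σ : C → ℕ) (x : ℕ),
        Function.update (fun e : G => σ e) ⟨c, hc⟩ x = fun e : G => Function.update σ c x e := by
      intro c hc σ x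
      funext e
      by_cases he : (e : C) = c
      · obtain rfl : e = ⟨c, hc⟩ := Subtype.ext he
        simp
      · rw [Function.update_of_ne (fun h => he (congrArg Subtype.val h)), Function.update_of_ne he]
    dsimp only
    cases hI : M q with
    | halt => exact ⟨.halt, fun σ => .inl ⟨rfl, rfl⟩⟩
    | nop p =>
      rw [hI] at hcl
      exact ⟨.nop ⟨p, hcl 0 _ rfl⟩, fun σ => .inr ⟨⟨p, hcl 0 _ rfl⟩, σ, rfl, rfl⟩⟩
    | inc c p =>
      rw [hI] at hcl
      have hc := hg c (.inl ⟨p, hI⟩)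
      refine ⟨.inc ⟨c, hc⟩ ⟨p, hcl 0 _ rfl⟩, fun σ => .inr ⟨⟨p, hcl 0 _ rfl⟩, _, rfl, ?_⟩⟩
      simp only [CounterInstruction.exec, hupd]
    | dec c p r =>
      rw [hI] at hcl
      have hc := hg c (.inr ⟨p, r, hI⟩)
      -- The valuations that are constantly 0 and constantly 1 take the two branches of the
      -- instruction.
      have hp : p ∈ F := by simpa [CounterInstruction.exec] using hcl 0 _ rfl
      have hr : r ∈ F := by simpa [CounterInstruction.exec] using hcl 1 _ rfl
      refine ⟨.dec ⟨c, hc⟩ ⟨p, hp⟩ ⟨r, hr⟩, fun σ => .inr ?_⟩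
      by_cases h0 : σ c = 0
      · exact ⟨⟨p, hp⟩, σ, by simp [CounterInstruction.exec, h0]⟩
      · exact ⟨⟨r, hr⟩, _, by simp only [CounterInstruction.exec, h0, if_false]; rfl,
          by simp only [CounterInstruction.exec, h0, if_false, hupd]⟩
  choose M' hM' using key
  refine ⟨F, G, hF.to_subtype, hG.to_subtype, inferInstance, M', ⟨q₀, hq₀⟩,
    ⟨c₀, Set.mem_insert _ _⟩, ?_⟩
  have main : ∀ (j : ℕ) (q : F) (σ : C → ℕ),
      HaltsIn M' j (q, fun c : G => σ c) ↔ HaltsIn M j (↑q, σ) := by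
    intro j
    induction j with
    | zero =>
      intro q σ
      constructor
      · rintro ⟨h⟩
        rcases hM' q σ with ⟨h', -⟩ | ⟨p, τ, -, h'⟩
        · exact .halt h'
        · simp [h'] at h
      · rintro ⟨h⟩
        rcases hM' q σ with ⟨-, h'⟩ | ⟨p, τ, h', -⟩
        · exact .halt h'
        · simp [h'] at h
    | succ j ih =>
      intro q σ
      constructor
      · rintro (_ | ⟨h, hd⟩)
        rcases hM' q σ with ⟨-, h'⟩ | ⟨p, τ, h'', h'⟩
        · simp [h'] at h
        · simp only [h', Option.some.injEq] at h
          subst h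
          exact .step h'' ((ih p τ).1 hd)
      · rintro (_ | ⟨h, hd⟩)
        rcases hM' q σ with ⟨h', -⟩ | ⟨p, τ, h'', h'⟩
        · simp [h'] at h
        · simp only [h'', Option.some.injEq] at h
          subst h
          exact .step h' ((ih p τ).2 hd)
  intro n j
  refine Iff.trans ?_ (main j ⟨q₀, hq₀⟩ _)
  refine iff_of_eq (congrArg (fun τ => HaltsIn M' j (_, τ)) ?_)
  funext e
  by_cases he : (e : C) = c₀
  · obtain rfl : e = ⟨c₀, Set.mem_insert _ _⟩ := Subtype.ext he
    simp
  · rw [Function.update_of_ne (fun h => he (congrArg Subtype.val h)), Function.update_of_ne he]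
    rfl

end CounterMachine

/-! ### Structured programs and their execution by a counter machine -/

/-- Structured programs over counters; `loop c P` decrements `c` and executes `P` as long as `c` is
not zero. -/
inductive CounterProgram : Type where
  | skip : CounterProgram
  | inc (c : ℕ) : CounterProgram
  | seq (P Q : CounterProgram) : CounterProgram
  | loop (c : ℕ) (P : CounterProgram) : CounterProgram

namespace CounterProgram

open CounterMachine Function

/-- The counter machine executing structured programs; its locations are stacks of programs. -/
def machine : List CounterProgram → CounterInstruction (List CounterProgram) ℕ
  | [] => .halt
  | skip :: k => .nop k
  | inc c :: k => .inc c k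
  | seq P Q :: k => .nop (P :: Q :: k)
  | loop c P :: k => .dec c k (P :: loop c P :: k)

/-- Only finitely many stacks are reachable. -/
theorem exists_finite_closed (P : CounterProgram) : ∀ k, ∃ F : Set (List CounterProgram),
    F.Finite ∧ P :: k ∈ F ∧
      ∀ q ∈ F, ∀ (σ : ℕ → ℕ) (d), (machine q).exec σ = some d → d.1 ∈ insert k F := by
  induction P with
  | skip =>
    refine fun k => ⟨{skip :: k}, Set.finite_singleton _, rfl, ?_⟩
    rintro q rfl σ d h
    cases h
    exact .inl rfl
  | inc c =>
    refine fun k => ⟨{inc c :: k}, Set.finite_singleton _, rfl, ?_⟩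
    rintro q rfl σ d h
    cases h
    exact .inl rfl
  | seq P Q ihP ihQ =>
    intro k
    obtain ⟨F, hF, hPF, hFc⟩ := ihP (Q :: k)
    obtain ⟨G, hG, hQG, hGc⟩ := ihQ k
    refine ⟨insert (seq P Q :: k) (F ∪ G), (hF.union hG).insert _, .inl rfl, ?_⟩
    rintro q (rfl | hq | hq) σ d h
    · cases h
      exact .inr (.inr (.inl hPF))
    · rcases hFc q hq σ d h with h | h
      · rw [h]
        exact .inr (.inr (.inr hQG))
      · exact .inr (.inr (.inl h))
    · rcases hGc q hq σ d h with h | h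
      · exact .inl h
      · exact .inr (.inr (.inr h))
  | loop c P ih =>
    intro k
    -- The body is executed with the loop itself on top of the remaining stack, so leaving the body
    -- leads back to a stack already listed.
    obtain ⟨F, hF, hPF, hFc⟩ := ih (loop c P :: k)
    refine ⟨insert (loop c P :: k) F, hF.insert _, .inl rfl, ?_⟩
    rintro q (rfl | hq) σ d h
    · simp only [machine, CounterInstruction.exec, Option.some.injEq] at h
      subst h
      split_ifs
      · exact .inl rfl
      · exact .inr (.inr hPF)
    · exact .inr (hFc q hq σ d h)

/-- The program transforms one valuation of the counters into another. -/
def Maps (P : CounterProgram) (σ τ : ℕ → ℕ) : Prop :=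
  ∀ k, Relation.ReflTransGen (Next machine) (P :: k, σ) (k, τ)

theorem maps_skip (σ : ℕ → ℕ) : skip.Maps σ σ := fun _ => .single rfl

theorem maps_inc (c : ℕ) (σ : ℕ → ℕ) : (inc c).Maps σ (update σ c (σ c + 1)) := fun _ => .single rfl

theorem Maps.seq {P Q : CounterProgram} {σ τ ρ : ℕ → ℕ} (hP : P.Maps σ τ) (hQ : Q.Maps τ ρ) :
    (seq P Q).Maps σ ρ :=
  fun k => .head rfl ((hP (Q :: k)).trans (hQ k))

theorem next_loop_zero {c : ℕ} {P : CounterProgram} {σ : ℕ → ℕ} (h : σ c = 0)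
    (k : List CounterProgram) : Next machine (loop c P :: k, σ) (k, σ) := by
  simp [Next, machine, CounterInstruction.exec, h]

theorem next_loop_pos {c : ℕ} {P : CounterProgram} {σ : ℕ → ℕ} (h : σ c ≠ 0)
    (k : List CounterProgram) :
    Next machine (loop c P :: k, σ) (P :: loop c P :: k, update σ c (σ c - 1)) := by
  simp [Next, machine, CounterInstruction.exec, h]

theorem maps_loop_zero {c : ℕ} {P : CounterProgram} {σ : ℕ → ℕ} (h : σ c = 0) :
    (loop c P).Maps σ σ :=
  fun k => .single (next_loop_zero h k)

/-- The valuation `s i` is the one with `i` iterations still to come, so the index runs downwards.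
The counter `c` itself need not have the value `i`; it only has to be nonzero exactly as long as
iterations remain. -/
theorem maps_loop {c : ℕ} {P : CounterProgram} {m : ℕ} (s : ℕ → ℕ → ℕ) (h₀ : s 0 c = 0)
    (hs : ∀ i < m, s (i + 1) c ≠ 0 ∧ P.Maps (update (s (i + 1)) c (s (i + 1) c - 1)) (s i)) :
    (loop c P).Maps (s m) (s 0) := by
  induction m with
  | zero => exact maps_loop_zero h₀
  | succ m ih =>
    intro k
    obtain ⟨h, h'⟩ := hs m (Nat.lt_succ_self m)
    exact .head (next_loop_pos h k)
      ((h' _).trans (ih (fun i hi => hs i (Nat.lt_succ_of_lt hi)) k))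

theorem Maps.congr {P : CounterProgram} {σ τ σ' τ' : ℕ → ℕ} (h : P.Maps σ τ)
    (hσ : ∀ r, σ' r = σ r) (hτ : ∀ r, τ' r = τ r) : P.Maps σ' τ' := by
  rwa [funext hσ, funext hτ]

/-- Setting a counter to zero. -/
def clear (c : ℕ) : CounterProgram := loop c skip

theorem maps_clear (c : ℕ) (σ : ℕ → ℕ) : (clear c).Maps σ (update σ c 0) := by
  have := maps_loop (c := c) (P := skip) (m := σ c) (fun i => update σ c i) (by simp) (by
    intro i _
    refine ⟨by simp, (maps_skip _).congr (fun r => ?_) (fun r => rfl)⟩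
    simp)
  exact this.congr (fun r => by simp) (fun r => rfl)

/-- Adding a counter to another one, which sets it to zero. -/
def move (c d : ℕ) : CounterProgram := loop c (inc d)

theorem maps_move {c d : ℕ} (h : c ≠ d) (σ : ℕ → ℕ) :
    (move c d).Maps σ (update (update σ c 0) d (σ d + σ c)) := by
  have := maps_loop (c := c) (P := inc d) (m := σ c)
    (fun i => update (update σ c i) d (σ d + (σ c - i))) (by simp [h]) (by
      intro i hi
      refine ⟨by simp [h], (maps_inc _ _).congr (fun r => rfl) (fun r => ?_)⟩
      simp only [update_apply]
      split_ifs <;> simp_all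
      omega)
  refine this.congr (fun r => ?_) (fun r => by simp)
  simp only [update_apply]
  split_ifs <;> simp_all

/-- Adding a counter to another one, with an auxiliary counter. -/
def copy (c t d : ℕ) : CounterProgram := seq (loop c (seq (inc t) (inc d))) (move t c)

theorem maps_copy {c t d : ℕ} (hct : c ≠ t) (hcd : c ≠ d) (htd : t ≠ d) {σ : ℕ → ℕ}
    (ht : σ t = 0) : (copy c t d).Maps σ (update σ d (σ d + σ c)) := by
  have := maps_loop (c := c) (P := seq (inc t) (inc d)) (m := σ c)
    (fun i => update (update (update σ c i) t (σ c - i)) d (σ d + (σ c - i)))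
    (by simp [hct, hcd]) (by
      intro i hi
      refine ⟨by simp [hct, hcd],
        ((maps_inc _ _).seq (maps_inc _ _)).congr (fun r => rfl) (fun r => ?_)⟩
      simp only [update_apply]
      split_ifs <;> simp_all <;> omega)
  refine ((this.congr (σ' := σ) (fun r => ?_) (fun r => rfl)).seq
    (maps_move hct.symm _)).congr (fun r => rfl) (fun r => ?_)
  · simp only [update_apply]
    split_ifs <;> simp_all
  · simp only [update_apply]
    split_ifs <;> simp_all

end CounterProgram

/-! ### Primitive recursive functions and unbounded search -/

namespace CounterProgram

open CounterMachine Function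

/-- The function `f` can be computed by programs whose auxiliary counters are beyond a given
bound. -/
def Implementable {n : ℕ} (f : List.Vector ℕ n → ℕ) : Prop :=
  ∀ (args : Fin n → ℕ) (out N : ℕ), (∀ i, args i < N) → out < N → (∀ i, args i ≠ out) →
    ∃ P : CounterProgram, ∀ σ : ℕ → ℕ, σ out = 0 → (∀ r, N ≤ r → σ r = 0) →
      P.Maps σ (update σ out (f (List.Vector.ofFn fun i => σ (args i))))

theorem implementable_zero : Implementable (n := 0) fun _ => 0 := by
  intro args out N _ _ _
  exact ⟨skip, fun σ h _ => (maps_skip σ).congr (fun r => rfl) (fun r => by simp [← h])⟩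

theorem implementable_get {n : ℕ} (i : Fin n) : Implementable fun v => v.get i := by
  intro args out N ha ho hao
  refine ⟨copy (args i) N out, fun σ h hN => ?_⟩
  refine (maps_copy (ha i).ne (hao i) ho.ne' (hN N le_rfl)).congr (fun r => rfl) (fun r => ?_)
  simp [h]

theorem implementable_succ : Implementable (n := 1) fun v => v.head.succ := by
  intro args out N ha ho hao
  refine ⟨seq (copy (args 0) N out) (inc out), fun σ h hN => ?_⟩
  refine ((maps_copy (ha 0).ne (hao 0) ho.ne' (hN N le_rfl)).seq (maps_inc _ _)).congr
    (fun r => rfl) (fun r => ?_)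
  simp [h, List.Vector.ofFn]

/-- Induction on the number `j` of components computed so far. Component `i` is stored in counter `N
+ i`, and each program takes its auxiliary counters beyond `M`, hence beyond all results. The outer
test `r - N < n` merely supplies the index of the component. -/
theorem exists_maps_tuple {m n : ℕ} {g : Fin n → List.Vector ℕ m → ℕ}
    (hg : ∀ i, Implementable (g i)) (args : Fin m → ℕ) (N M : ℕ) (hNM : N + n ≤ M)
    (ha : ∀ i, args i < N) :
    ∀ j, ∃ P : CounterProgram, ∀ σ : ℕ → ℕ, (∀ r, N ≤ r → σ r = 0) →
      P.Maps σ (fun r => if h : r - N < n then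
        (if N ≤ r ∧ r < N + j then g ⟨r - N, h⟩ (List.Vector.ofFn fun i => σ (args i)) else σ r)
        else σ r) := by
  intro j
  induction j with
  | zero =>
    refine ⟨skip, fun σ _ => (maps_skip σ).congr (fun r => rfl) (fun r => ?_)⟩
    have : ¬ (N ≤ r ∧ r < N + 0) := by omega
    simp only [if_neg this, dite_eq_ite, ite_self]
  | succ j ih =>
    obtain ⟨P, hP⟩ := ih
    by_cases hj : j < n
    · obtain ⟨P', hP'⟩ := hg ⟨j, hj⟩ args (N + j) M (fun i => by have := ha i; omega) (by omega)
        (fun i => by have := ha i; omega)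
      refine ⟨seq P P', fun σ hσ => (hP σ hσ).seq ((hP' _ ?_ ?_).congr (fun r => rfl) ?_)⟩
      · have : ¬ (N ≤ N + j ∧ N + j < N + j) := by omega
        simp only [if_neg this, dite_eq_ite, ite_self]
        exact hσ _ (by omega)
      · intro r hr
        have : ¬ r - N < n := by omega
        rw [dif_neg this]
        exact hσ _ (by omega)
      · intro r
        have hargs : ∀ i, (if h : args i - N < n then
            (if N ≤ args i ∧ args i < N + j then
              g ⟨args i - N, h⟩ (List.Vector.ofFn fun i => σ (args i)) else σ (args i))
            else σ (args i)) = σ (args i) := by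
          intro i
          have : ¬ (N ≤ args i ∧ args i < N + j) := by have := ha i; omega
          simp only [if_neg this, dite_eq_ite, ite_self]
        simp only [hargs]
        by_cases hr : r = N + j
        · subst hr
          simp [hj]
        · rw [update_of_ne hr]
          have : (N ≤ r ∧ r < N + (j + 1)) ↔ (N ≤ r ∧ r < N + j) := by omega
          simp only [this]
    · refine ⟨P, fun σ hσ => (hP σ hσ).congr (fun r => rfl) (fun r => ?_)⟩
      split_ifs <;> first | rfl | omega

theorem exists_maps_clear_range (N : ℕ) : ∀ j, ∃ P : CounterProgram, ∀ σ : ℕ → ℕ,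
    P.Maps σ (fun r => if N ≤ r ∧ r < N + j then 0 else σ r) := by
  intro j
  induction j with
  | zero =>
    refine ⟨skip, fun σ => (maps_skip σ).congr (fun r => rfl) (fun r => ?_)⟩
    rw [if_neg (by omega)]
  | succ j ih =>
    obtain ⟨P, hP⟩ := ih
    refine ⟨seq P (clear (N + j)), fun σ => ((hP σ).seq (maps_clear _ _)).congr (fun r => rfl)
      (fun r => ?_)⟩
    rw [update_apply]
    split_ifs <;> first | rfl | omega

/-- The inner values are stored in the counters from `N` to `N + n - 1` while the outer function is
computed beyond them. They are cleared at the end, because an implementation may change nothing but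
its output. -/
theorem Implementable.comp {m n : ℕ} {f : List.Vector ℕ n → ℕ}
    {g : Fin n → List.Vector ℕ m → ℕ} (hf : Implementable f) (hg : ∀ i, Implementable (g i)) :
    Implementable fun v => f (List.Vector.ofFn fun i => g i v) := by
  intro args out N ha ho hao
  obtain ⟨P, hP⟩ := exists_maps_tuple hg args N (N + n) le_rfl ha n
  obtain ⟨P', hP'⟩ := hf (fun i => N + i) out (N + n) (fun i => by have := i.2; omega) (by omega)
    (fun i => by omega)
  obtain ⟨P'', hP''⟩ := exists_maps_clear_range N n
  refine ⟨seq P (seq P' P''), fun σ h hN => ((hP σ hN).seq ((hP' _ ?_ ?_).seq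
    (hP'' _))).congr (fun r => rfl) (fun r => ?_)⟩
  · have : ¬ (N ≤ out ∧ out < N + n) := by omega
    simp only [if_neg this, dite_eq_ite, ite_self, h]
  · intro r hr
    rw [dif_neg (by omega)]
    exact hN r (by omega)
  · by_cases hr : r = out
    · subst hr
      rw [if_neg (by omega)]
      simp
    · rw [update_of_ne hr]
      split_ifs with h'
      · exact hN r h'.1
      · rw [update_of_ne hr]
        simp [h']

theorem Implementable.prec {n : ℕ} {f : List.Vector ℕ n → ℕ} {g : List.Vector ℕ (n + 2) → ℕ}
    (hf : Implementable f) (hg : Implementable g) :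
    Implementable fun v : List.Vector ℕ (n + 1) =>
      v.head.rec (f v.tail) fun y IH => g (y ::ᵥ IH ::ᵥ v.tail) := by
  intro args out N ha ho hao
  obtain ⟨Pf, hPf⟩ := hf (fun i => args i.succ) N (N + 4)
    (fun i => by have := ha i.succ; omega) (by omega) (fun i => by have := ha i.succ; omega)
  obtain ⟨Pg, hPg⟩ := hg (Fin.cons (N + 1) (Fin.cons N fun i => args i.succ)) (N + 3) (N + 4)
    (by
      refine Fin.cases (by simp) (Fin.cases (by simp) fun i => ?_)
      have := ha i.succ
      simp
      omega) (by omega)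
    (by
      refine Fin.cases (by simp) (Fin.cases (by simp) fun i => ?_)
      have := ha i.succ
      simp
      omega)
  -- Counter `N` holds the value of the recursion, `N + 1` its argument, `N + 2` the number of
  -- iterations left, and `N + 3` is auxiliary for the copy and then receives each new value.
  refine ⟨seq (copy (args 0) (N + 3) (N + 2)) (seq Pf (seq (loop (N + 2) (seq Pg (seq (clear N)
    (seq (move (N + 3) N) (inc (N + 1)))))) (seq (move N out) (clear (N + 1))))),
    fun σ h hN => ?_⟩
  set v : List.Vector ℕ n := List.Vector.ofFn fun i => σ (args i.succ) with hv
  set R : ℕ → ℕ := fun x => Nat.rec (f v) (fun y IH => g (y ::ᵥ IH ::ᵥ v)) x with hR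
  have hR1 : ∀ y, R (y + 1) = g (y ::ᵥ R y ::ᵥ v) := fun y => rfl
  set m := σ (args 0) with hm
  have h0 : args 0 < N := ha 0
  have hargs : ∀ i : Fin n, args i.succ < N := fun i => ha i.succ
  have z0 := hN N le_rfl
  have z1 := hN (N + 1) (by omega)
  have z2 := hN (N + 2) (by omega)
  have z3 := hN (N + 3) (by omega)
  -- The valuation before the last `i` iterations.
  let s : ℕ → ℕ → ℕ := fun i =>
    update (update (update σ N (R (m - i))) (N + 1) (m - i)) (N + 2) i
  have hloop := maps_loop (c := N + 2) (P := seq Pg (seq (clear N) (seq (move (N + 3) N)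
    (inc (N + 1))))) (m := m) s (by simp [s]) (by
      intro i hi
      refine ⟨by simp [s], ?_⟩
      have hvec : (List.Vector.ofFn fun j => update (s (i + 1)) (N + 2) (s (i + 1) (N + 2) - 1)
          ((Fin.cons (N + 1) (Fin.cons N fun i => args i.succ) : Fin (n + 2) → ℕ) j)) =
          (m - (i + 1)) ::ᵥ R (m - (i + 1)) ::ᵥ v := by
        rw [List.Vector.ofFn, List.Vector.ofFn, hv]
        congr 1
        · simp [s]
        congr 1
        · simp [s]
        congr 1
        funext j
        have := hargs j
        simp only [s, Fin.cons_succ, update_apply]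
        split_ifs <;> first | rfl | omega
      have hi' : m - i = (m - (i + 1)) + 1 := by omega
      refine ((hPg _ ?_ ?_).seq ((maps_clear _ _).seq ((maps_move (by omega) _).seq
        (maps_inc _ _)))).congr (fun r => rfl) (fun r => ?_)
      · simp [s, z3]
      · intro r hr
        simp only [s, update_apply]
        split_ifs <;> first | omega | exact hN r (by omega)
      · rw [hvec, ← hR1, ← hi']
        simp only [s, update_apply]
        split_ifs <;> first | omega | simp_all)
  have hcopy := maps_copy (c := args 0) (t := N + 3) (d := N + 2) (by omega) (by omega) (by omega)
    (σ := σ) z3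
  refine (hcopy.seq ((hPf _ ?_ ?_).seq ((hloop.congr (fun r => ?_) (fun r => rfl)).seq
    ((maps_move (by omega) _).seq (maps_clear _ _))))).congr (fun r => rfl) (fun r => ?_)
  · simp [z0]
  · intro r hr
    rw [update_of_ne (by omega)]
    exact hN r (by omega)
  · have hvec : (List.Vector.ofFn fun j : Fin n => update σ (N + 2) (σ (N + 2) + σ (args 0))
          (args j.succ)) = v := by
      rw [hv]
      congr 1
      funext j
      have := hargs j
      rw [update_of_ne (by omega)]
    rw [hvec]
    simp only [s, update_apply, Nat.sub_self]
    split_ifs <;> simp_all [R]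
  · have hval : (List.Vector.ofFn fun i => σ (args i)) = m ::ᵥ v := rfl
    rw [hval]
    simp only [s, update_apply, Nat.sub_zero, List.Vector.head_cons, List.Vector.tail_cons]
    have hR' : (Nat.rec (f v) (fun y IH => g (y ::ᵥ IH ::ᵥ v)) m : ℕ) = R m := rfl
    rw [hR']
    split_ifs <;> first | omega | (rename_i h₁; subst h₁; omega)

theorem implementable_of_primrec' {n : ℕ} {f : List.Vector ℕ n → ℕ} (hf : Nat.Primrec' f) :
    Implementable f := by
  induction hf with
  | zero => exact implementable_zero
  | succ => exact implementable_succ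
  | get i => exact implementable_get i
  | comp g _ _ ihf ihg => exact ihf.comp ihg
  | prec _ _ ihf ihg => exact ihf.prec ihg

/-- Unbounded search for a zero of a primitive recursive function. -/
theorem exists_search {g : ℕ → ℕ → ℕ} (hg : Primrec₂ g) :
    ∃ P : CounterProgram, ∀ n, (∃ j, HaltsIn machine j ([P], update 0 0 n)) ↔ ∃ y, g y n = 0 := by
  obtain ⟨Pg, hPg⟩ := implementable_of_primrec' (Nat.Primrec'.prim_iff₂.2 hg) ![1, 0] 2 4
    (by intro i; fin_cases i <;> simp) (by omega) (by intro i; fin_cases i <;> simp)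
  -- Counter 0 holds the input, 1 the candidate `y`, 2 the value `g y n`, and 3 is a flag. Entering
  -- the loop clears the flag; a nonzero value sets it again and passes to the next candidate.
  let body : CounterProgram := seq Pg (loop 2 (seq (clear 2) (seq (inc 3) (inc 1))))
  refine ⟨seq (inc 3) (loop 3 body), fun n => ?_⟩
  let s : ℕ → ℕ → ℕ := fun y => update (update (update 0 0 n) 1 y) 3 1
  have hbody : ∀ y k, Relation.ReflTransGen (Next machine)
      (body :: k, update (s y) 3 0) (loop 2 (seq (clear 2) (seq (inc 3) (inc 1))) :: k,
        update (update (s y) 3 0) 2 (g y n)) := by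
    intro y k
    refine .head rfl ?_
    have := hPg (update (s y) 3 0) (by simp [s]) (by
      intro r hr
      simp only [s, update_apply, Pi.zero_apply]
      split_ifs <;> omega)
    refine (this.congr (fun r => rfl) (fun r => ?_)) _
    simp [s, List.Vector.ofFn]
  have hstart : Relation.ReflTransGen (Next machine) ([seq (inc 3) (loop 3 body)], update 0 0 n)
      ([loop 3 body], s 0) := by
    refine .head rfl (.single ?_)
    simp only [Next, machine, CounterInstruction.exec, Option.some.injEq, Prod.mk.injEq, true_and]
    funext r
    simp only [s, update_apply, Pi.zero_apply]
    split_ifs <;> simp_all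
  have henter : ∀ y, Next machine ([loop 3 body], s y) (body :: [loop 3 body], update (s y) 3 0) := by
    intro y
    have := next_loop_pos (c := 3) (P := body) (σ := s y) (by simp [s]) []
    simpa [s] using this
  have hzero : ∀ y, g y n = 0 → ∃ j, HaltsIn machine j ([loop 3 body], s y) := by
    intro y hy
    rw [exists_haltsIn_iff (.head (henter y) (hbody y _)), exists_haltsIn_iff
      (.head (next_loop_zero (by simp [hy]) _) (.single (next_loop_zero (by simp) _)))]
    exact ⟨0, .halt rfl⟩
  have hpos : ∀ y, g y n ≠ 0 → Relation.TransGen (Next machine) ([loop 3 body], s y)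
      ([loop 3 body], s (y + 1)) := by
    intro y hy
    refine .head' (henter y) ((hbody y _).trans (.head (next_loop_pos (by simpa using hy) _) ?_))
    refine (((maps_clear 2 _).seq ((maps_inc 3 _).seq (maps_inc 1 _))) _).trans
      (.single ?_)
    have := next_loop_zero (c := 2) (P := seq (clear 2) (seq (inc 3) (inc 1)))
      (σ := s (y + 1)) (by simp [s]) [loop 3 body]
    convert this using 2
    funext r
    simp only [s, update_apply, Pi.zero_apply]
    split_ifs <;> simp_all
  rw [exists_haltsIn_iff hstart]
  constructor
  · rintro ⟨j, hj⟩
    by_contra! hne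
    -- Infinite descent: if no candidate is a zero, a halting computation contains a shorter one
    -- beginning at the next candidate.
    have : ∀ j y, ¬ HaltsIn machine j ([loop 3 body], s y) := by
      intro j
      induction j using Nat.strong_induction_on with
      | _ j ih =>
        intro y hy
        obtain ⟨i, hi, h⟩ := haltsIn_of_transGen (hpos y (hne y)) hy
        exact ih i hi _ h
    exact this j 0 hj
  · rintro ⟨y, hy⟩
    -- Induction on the distance `d` to a known zero; an earlier zero only stops the search sooner.
    have : ∀ d y, g (y + d) n = 0 → ∃ j, HaltsIn machine j ([loop 3 body], s y) := by
      intro d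
      induction d with
      | zero => exact hzero
      | succ d ih =>
        intro y hy
        by_cases h0 : g y n = 0
        · exact hzero y h0
        · rw [exists_haltsIn_iff (hpos y h0).to_reflTransGen]
          exact ih (y + 1) (by rw [← hy]; congr 1; omega)
    exact this y 0 (by simpa using hy)

end CounterProgram

/-- There is a counter machine whose halting problem is undecidable. -/
theorem exists_undecidable_counterMachine :
    ∃ (Λ C : Type) (_ : Finite Λ) (_ : Finite C) (_ : DecidableEq C)
      (M : Λ → CounterInstruction Λ C) (q₀ : Λ) (c₀ : C),
      ¬ ComputablePred fun n : ℕ => ∃ j, HaltsIn M j (q₀, Function.update 0 c₀ n) := by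
  -- A zero of `g · n` is a bound within which the program with number `n` is seen to halt on input
  -- 0.
  let g : ℕ → ℕ → ℕ := fun y n =>
    if (Nat.Partrec.Code.evaln y (Denumerable.ofNat Nat.Partrec.Code n) 0).isSome then 0 else 1
  have hg : Primrec₂ g := by
    have h : Primrec fun p : ℕ × ℕ =>
        (Nat.Partrec.Code.evaln p.1 (Denumerable.ofNat Nat.Partrec.Code p.2) 0).isSome :=
      Primrec.option_isSome.comp (Nat.Partrec.Code.primrec_evaln.comp
        (((Primrec.fst.pair ((Primrec.ofNat Nat.Partrec.Code).comp Primrec.snd))).pair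
          (Primrec.const 0)))
    exact (Primrec.ite (Primrec.eq.comp h (Primrec.const true)) (Primrec.const 0)
      (Primrec.const 1)).to₂
  obtain ⟨P, hP⟩ := CounterProgram.exists_search hg
  obtain ⟨F, hF, hPF, hFc⟩ := P.exists_finite_closed []
  obtain ⟨Λ, C, hΛ, hC, hdec, M, q₀, c₀, hM⟩ := CounterMachine.exists_restrict
    CounterProgram.machine (hF.insert []) (by
      rintro q (rfl | hq) σ d h
      · cases h
      · exact hFc q hq σ d h) (Set.mem_insert_of_mem [] hPF) 0
  refine ⟨Λ, C, hΛ, hC, hdec, M, q₀, c₀, fun h => ?_⟩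
  refine ComputablePred.halting_problem 0 (ComputablePred.of_eq (p := fun c : Nat.Partrec.Code =>
    ∃ j, HaltsIn M j (q₀, Function.update 0 c₀ (Encodable.encode c))) ?_ ?_)
  · obtain ⟨f, hf, hfe⟩ := ComputablePred.computable_iff.1 h
    refine ComputablePred.computable_iff.2 ⟨fun c => f (Encodable.encode c),
      hf.comp Computable.encode, ?_⟩
    funext c
    exact congrFun hfe _
  · intro c
    simp only [hM, hP, g]
    rw [Part.dom_iff_mem]
    constructor
    · rintro ⟨y, hy⟩
      have : (Nat.Partrec.Code.evaln y c 0).isSome := by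
        by_contra hne
        simp [hne] at hy
      obtain ⟨x, hx⟩ := Option.isSome_iff_exists.1 this
      exact ⟨x, Nat.Partrec.Code.evaln_sound hx⟩
    · rintro ⟨x, hx⟩
      obtain ⟨y, hy⟩ := Nat.Partrec.Code.evaln_complete.1 hx
      exact ⟨y, by simp [Option.mem_def.1 hy]⟩

/-! ### Block conditions and the automaton detecting their violation -/

/-- The local conditions on data words that are divided into blocks by separators: which symbols
may be adjacent, and which symbols have to be followed by a matching symbol with the same atom in
the next block. Every `reset` has to be followed by a given number of `load`s before a `step`. -/
structure BlockDiscipline (S : Type) where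
  sep : S → Prop
  adj : Option S → S → Prop
  accept : Option S → Prop
  need : S → Prop
  mat : S → S → Prop
  reset : S → Prop
  load : S → Prop
  step : S → Prop

namespace BlockDiscipline

variable {S 𝔸 : Type} (D : BlockDiscipline S)

/-- The atom `a` occurs before the first separator. -/
def Dup (a : 𝔸) : List (S × 𝔸) → Prop
  | [] => False
  | b :: v => ¬ D.sep b.1 ∧ (b.2 = a ∨ Dup a v)

/-- The atom `a` does not occur with a matching symbol before the first separator. -/
def Miss (σ : S) (a : 𝔸) : List (S × 𝔸) → Prop
  | [] => True
  | b :: v => D.sep b.1 ∨ (¬ D.sep b.1 ∧ ¬ (D.mat σ b.1 ∧ b.2 = a) ∧ Miss σ a v)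

/-- The atom `a` does not occur with a matching symbol in the next block. -/
def Lost (σ : S) (a : 𝔸) : List (S × 𝔸) → Prop
  | [] => True
  | b :: v => (D.sep b.1 ∧ D.Miss σ a v) ∨ (¬ D.sep b.1 ∧ Lost σ a v)

/-- There are fewer than `r` loads before a step, or more than `r` loads. -/
def Miscount : ℕ → List (S × 𝔸) → Prop
  | _, [] => False
  | r, b :: v => (¬ D.sep b.1 ∧ Miscount r v) ∨
      (D.load b.1 ∧ (r = 0 ∨ ∃ i, r = i + 1 ∧ Miscount i v)) ∨ (D.step b.1 ∧ r ≠ 0)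

/-- The word, following the symbol `o`, violates one of the conditions. -/
def Err (n : ℕ) : Option S → List (S × 𝔸) → Prop
  | o, [] => ¬ D.accept o
  | o, b :: v => ¬ D.adj o b.1 ∨ (¬ D.sep b.1 ∧ D.Dup b.2 v) ∨ (D.need b.1 ∧ D.Lost b.1 b.2 v) ∨
      (D.reset b.1 ∧ D.Miscount n v) ∨ Err n (some b.1) v

/-- Updates the atoms of the previous block and those of the current block. -/
noncomputable def advance (r : List 𝔸 × List 𝔸) (b : S × 𝔸) : List 𝔸 × List 𝔸 :=
  open Classical in if D.sep b.1 then (r.2, []) else (r.1, b.2 :: r.2)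

/-- At most `K` symbols between successive separators, where `r` symbols have already been read. -/
def BlocksLE (K : ℕ) : ℕ → List (S × 𝔸) → Prop
  | r, [] => r ≤ K
  | r, b :: v => r ≤ K ∧ (D.sep b.1 → BlocksLE K 0 v) ∧ (¬ D.sep b.1 → BlocksLE K (r + 1) v)

variable {D}

theorem BlocksLE.foldl_advance {K : ℕ} {u v : List (S × 𝔸)} {r : List 𝔸 × List 𝔸}
    (h : D.BlocksLE K r.2.length (u ++ v)) (hr : r.1.length ≤ K) :
    (u.foldl D.advance r).1.length ≤ K ∧ (u.foldl D.advance r).2.length ≤ K := by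
  induction u generalizing r with
  | nil => cases v <;> simp_all [BlocksLE]
  | cons b u ih =>
    obtain ⟨h₁, h₂, h₃⟩ := h
    by_cases hb : D.sep b.1
    · refine ih (r := D.advance r b) ?_ ?_
      · simpa [advance, hb] using h₂ hb
      · simpa [advance, hb] using h₁
    · refine ih (r := D.advance r b) ?_ ?_
      · simpa [advance, hb] using h₃ hb
      · simpa [advance, hb] using hr

end BlockDiscipline

/-- The control locations that do not count. -/
inductive ErrorLocation (S : Type) : Type where
  | scan (o : Option S) : ErrorLocation S
  | dup : ErrorLocation S
  | lost (σ : S) : ErrorLocation S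
  | miss (σ : S) : ErrorLocation S
  | sink : ErrorLocation S

instance {S : Type} [Finite S] : Finite (ErrorLocation S) := by
  refine Finite.of_injective (β := Option S ⊕ S ⊕ S ⊕ Bool) (fun
    | .scan o => .inl o
    | .dup => .inr (.inr (.inr true))
    | .lost σ => .inr (.inl σ)
    | .miss σ => .inr (.inr (.inl σ))
    | .sink => .inr (.inr (.inr false))) ?_
  rintro (_ | _ | _ | _ | _) (_ | _ | _ | _ | _) h <;> simp_all

namespace BlockDiscipline

open RegisterAutomaton ErrorLocation

open Classical in
/-- The singleton list if the condition holds, and the empty list otherwise. -/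
noncomputable def listIf {α : Type} (p : Prop) (x : α) : List α := if p then [x] else []

theorem mem_listIf {α : Type} {p : Prop} {x y : α} : y ∈ listIf p x ↔ p ∧ y = x := by
  by_cases h : p <;> simp [listIf, h]

variable {S : Type} (D : BlockDiscipline S) [Fintype S]

/-- A rule without guard and update. -/
def move {Q : Type} (p : Q) (τ : S) (q : Q) : TransitionRule (Fin 1) S Q :=
  ⟨p, τ, .tru, fun _ => false, q⟩

/-- The guard stating that the register contains the input. -/
def same : Constraint (Option (Fin 1)) := .eq none (some 0)

/-- The rules that do not depend on the number of loads. -/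
noncomputable def fixedRules : List (TransitionRule (Fin 1) S (ErrorLocation S)) :=
  (Finset.univ : Finset (Option S × S)).toList.flatMap (fun t =>
    listIf (¬ D.adj t.1 t.2) (move (scan t.1) t.2 sink) ++
    [move (scan t.1) t.2 (scan (some t.2))] ++
    listIf (¬ D.sep t.2) ⟨scan t.1, t.2, .tru, fun _ => true, dup⟩ ++
    listIf (D.need t.2) ⟨scan t.1, t.2, .tru, fun _ => true, lost t.2⟩) ++
  (Finset.univ : Finset S).toList.flatMap (fun τ =>
    listIf (¬ D.sep τ) ⟨dup, τ, same, fun _ => false, sink⟩ ++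
    listIf (¬ D.sep τ) (move dup τ dup) ++ [move sink τ sink]) ++
  (Finset.univ : Finset (S × S)).toList.flatMap (fun t =>
    listIf (¬ D.sep t.2) (move (lost t.1) t.2 (lost t.1)) ++
    listIf (D.sep t.2) (move (lost t.1) t.2 (miss t.1)) ++
    listIf (D.sep t.2) (move (miss t.1) t.2 sink) ++
    listIf (¬ D.sep t.2 ∧ ¬ D.mat t.1 t.2) (move (miss t.1) t.2 (miss t.1)) ++
    listIf (¬ D.sep t.2) ⟨miss t.1, t.2, same.neg, fun _ => false, miss t.1⟩)

/-- The rules for starting to count, with target `q`. -/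
noncomputable def startRules {Q : Type} (i : ErrorLocation S → Q) (q : Q) :
    List (TransitionRule (Fin 1) S Q) :=
  (Finset.univ : Finset (Option S × S)).toList.flatMap (fun t =>
    listIf (D.reset t.2) (move (i (scan t.1)) t.2 q))

/-- The rules for counting when no load is missing. -/
noncomputable def zeroRules {Q : Type} (s q : Q) : List (TransitionRule (Fin 1) S Q) :=
  (Finset.univ : Finset S).toList.flatMap (fun τ =>
    listIf (¬ D.sep τ) (move q τ q) ++ listIf (D.load τ) (move q τ s))

/-- The rules for counting when some load is missing. -/
noncomputable def succRules {Q : Type} (s q q' : Q) : List (TransitionRule (Fin 1) S Q) :=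
  (Finset.univ : Finset S).toList.flatMap (fun τ =>
    listIf (¬ D.sep τ) (move q τ q) ++ listIf (D.load τ) (move q τ q') ++
    listIf (D.step τ) (move q τ s))

/-- The final locations. -/
noncomputable def fixedFinal : List (ErrorLocation S) :=
  (Finset.univ : Finset (Option S)).toList.flatMap (fun o => listIf (¬ D.accept o) (scan o)) ++
  (Finset.univ : Finset S).toList.flatMap (fun σ => [lost σ, miss σ]) ++ [sink]

/-- The automaton detecting violations of the conditions. -/
noncomputable def errorAutomaton (n : ℕ) :
    RegisterAutomaton (Fin 1) S (ErrorLocation S ⊕ Fin (n + 1)) where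
  init := [.inl (scan none)]
  final := D.fixedFinal.map .inl
  rules := D.fixedRules.map (fun r => ⟨.inl r.src, r.sym, r.guard, r.upd, .inl r.dst⟩) ++
    D.startRules .inl (.inr (Fin.last n)) ++ D.zeroRules (.inl sink) (.inr 0) ++
    (List.finRange n).flatMap fun i => D.succRules (.inl sink) (.inr i.succ) (.inr i.castSucc)

variable {D} {𝔸 : Type} {n : ℕ} {μ : Fin 1 → Option 𝔸} {b : S × 𝔸}
  {d : (ErrorLocation S ⊕ Fin (n + 1)) × (Fin 1 → Option 𝔸)}

/-- All guessing takes place here: the automaton either scans on or commits itself to one kind of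
violation at the current symbol. The register is written only when an atom has to be compared later.
-/
theorem step_scan {o : Option S} :
    (D.errorAutomaton n).Step (.inl (scan o), μ) b d ↔
      (¬ D.adj o b.1 ∧ d = (.inl sink, μ)) ∨ d = (.inl (scan (some b.1)), μ) ∨
      (¬ D.sep b.1 ∧ d = (.inl dup, fun _ => some b.2)) ∨
      (D.need b.1 ∧ d = (.inl (lost b.1), fun _ => some b.2)) ∨
      (D.reset b.1 ∧ d = (.inr (Fin.last n), μ)) := by
  simp [Step, errorAutomaton, fixedRules, startRules, zeroRules, succRules, mem_listIf, move,
    or_and_right, exists_or, Constraint.Sat, same]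
  tauto

theorem step_sink : (D.errorAutomaton n).Step (.inl sink, μ) b d ↔ d = (.inl sink, μ) := by
  simp [Step, errorAutomaton, fixedRules, startRules, zeroRules, succRules, mem_listIf, move,
    or_and_right, exists_or, Constraint.Sat, same]

theorem step_dup {e : 𝔸} :
    (D.errorAutomaton n).Step (.inl dup, fun _ => some e) b d ↔
      (¬ D.sep b.1 ∧ b.2 = e ∧ d = (.inl sink, fun _ => some e)) ∨
      (¬ D.sep b.1 ∧ d = (.inl dup, fun _ => some e)) := by
  simp [Step, errorAutomaton, fixedRules, startRules, zeroRules, succRules, mem_listIf, move,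
    or_and_right, exists_or, Constraint.Sat, same]

theorem step_lost {σ : S} :
    (D.errorAutomaton n).Step (.inl (lost σ), μ) b d ↔
      (¬ D.sep b.1 ∧ d = (.inl (lost σ), μ)) ∨ (D.sep b.1 ∧ d = (.inl (miss σ), μ)) := by
  simp [Step, errorAutomaton, fixedRules, startRules, zeroRules, succRules, mem_listIf, move,
    or_and_right, exists_or, Constraint.Sat, same]

theorem step_miss {σ : S} {e : 𝔸} :
    (D.errorAutomaton n).Step (.inl (miss σ), fun _ => some e) b d ↔
      (D.sep b.1 ∧ d = (.inl sink, fun _ => some e)) ∨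
      (¬ D.sep b.1 ∧ ¬ (D.mat σ b.1 ∧ b.2 = e) ∧ d = (.inl (miss σ), fun _ => some e)) := by
  simp [Step, errorAutomaton, fixedRules, startRules, zeroRules, succRules, mem_listIf, move,
    or_and_right, exists_or, Constraint.Sat, same]
  tauto

theorem step_count_zero :
    (D.errorAutomaton n).Step (.inr 0, μ) b d ↔
      (¬ D.sep b.1 ∧ d = (.inr 0, μ)) ∨ (D.load b.1 ∧ d = (.inl sink, μ)) := by
  simp [Step, errorAutomaton, fixedRules, startRules, zeroRules, succRules, mem_listIf, move,
    or_and_right, exists_or, Constraint.Sat, same]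

theorem step_count_succ {i : Fin n} :
    (D.errorAutomaton n).Step (.inr i.succ, μ) b d ↔
      (¬ D.sep b.1 ∧ d = (.inr i.succ, μ)) ∨ (D.load b.1 ∧ d = (.inr i.castSucc, μ)) ∨
      (D.step b.1 ∧ d = (.inl sink, μ)) := by
  simp [Step, errorAutomaton, fixedRules, startRules, zeroRules, succRules, mem_listIf, move,
    or_and_right, exists_or, Constraint.Sat, same]
  simp [(Fin.succ_ne_zero _).symm]

theorem accepts_sink (w : List (S × 𝔸)) : (D.errorAutomaton n).Accepts (.inl sink, μ) w := by
  induction w with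
  | nil => simp [accepts_nil, errorAutomaton, fixedFinal]
  | cons b w ih => exact accepts_cons.2 ⟨_, step_sink.2 rfl, ih⟩

theorem accepts_dup {e : 𝔸} {w : List (S × 𝔸)} :
    (D.errorAutomaton n).Accepts (.inl dup, fun _ => some e) w ↔ D.Dup e w := by
  induction w with
  | nil => simp [accepts_nil, errorAutomaton, fixedFinal, Dup, mem_listIf]
  | cons b w ih =>
    simp only [accepts_cons, step_dup, Dup, ← ih]
    constructor
    · rintro ⟨d, ⟨h, h', -⟩ | ⟨h, rfl⟩, hw⟩
      · exact ⟨h, .inl h'⟩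
      · exact ⟨h, .inr hw⟩
    · rintro ⟨h, h' | hw⟩
      · exact ⟨_, .inl ⟨h, h', rfl⟩, accepts_sink w⟩
      · exact ⟨_, .inr ⟨h, rfl⟩, hw⟩

theorem accepts_miss {σ : S} {e : 𝔸} {w : List (S × 𝔸)} :
    (D.errorAutomaton n).Accepts (.inl (miss σ), fun _ => some e) w ↔ D.Miss σ e w := by
  induction w with
  | nil => simp [accepts_nil, errorAutomaton, fixedFinal, Miss]
  | cons b w ih =>
    simp only [accepts_cons, step_miss, Miss, ← ih]
    constructor
    · rintro ⟨d, ⟨h, -⟩ | ⟨h, h', rfl⟩, hw⟩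
      · exact .inl h
      · exact .inr ⟨h, h', hw⟩
    · rintro (h | ⟨h, h', hw⟩)
      · exact ⟨_, .inl ⟨h, rfl⟩, accepts_sink w⟩
      · exact ⟨_, .inr ⟨h, h', rfl⟩, hw⟩

theorem accepts_lost {σ : S} {e : 𝔸} {w : List (S × 𝔸)} :
    (D.errorAutomaton n).Accepts (.inl (lost σ), fun _ => some e) w ↔ D.Lost σ e w := by
  induction w with
  | nil => simp [accepts_nil, errorAutomaton, fixedFinal, Lost]
  | cons b w ih =>
    simp only [accepts_cons, step_lost, Lost, ← ih, ← accepts_miss (n := n)]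
    constructor
    · rintro ⟨d, ⟨h, rfl⟩ | ⟨h, rfl⟩, hw⟩
      · exact .inr ⟨h, hw⟩
      · exact .inl ⟨h, hw⟩
    · rintro (⟨h, hw⟩ | ⟨h, hw⟩)
      · exact ⟨_, .inr ⟨h, rfl⟩, hw⟩
      · exact ⟨_, .inl ⟨h, rfl⟩, hw⟩

/-- The location `.inr i` records that `i` more loads are expected. Miscounts thus need no register,
and `n` affects neither the alphabet nor the number of registers. -/
theorem accepts_count {i : Fin (n + 1)} {w : List (S × 𝔸)} :
    (D.errorAutomaton n).Accepts (.inr i, μ) w ↔ D.Miscount i w := by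
  induction w generalizing i with
  | nil => simp [accepts_nil, errorAutomaton, Miscount]
  | cons b w ih =>
    refine Fin.cases ?_ (fun i => ?_) i
    · simp only [accepts_cons, step_count_zero, Miscount]
      constructor
      · rintro ⟨d, ⟨h, rfl⟩ | ⟨h, rfl⟩, hw⟩
        · exact .inl ⟨h, ih.1 hw⟩
        · exact .inr (.inl ⟨h, .inl rfl⟩)
      · rintro (⟨h, hw⟩ | ⟨h, -⟩ | ⟨-, h⟩)
        · exact ⟨_, .inl ⟨h, rfl⟩, ih.2 hw⟩
        · exact ⟨_, .inr ⟨h, rfl⟩, accepts_sink w⟩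
        · exact absurd rfl h
    · simp only [accepts_cons, step_count_succ, Miscount]
      constructor
      · rintro ⟨d, ⟨h, rfl⟩ | ⟨h, rfl⟩ | ⟨h, rfl⟩, hw⟩
        · exact .inl ⟨h, ih.1 hw⟩
        · exact .inr (.inl ⟨h, .inr ⟨i, by simp, ih.1 hw⟩⟩)
        · exact .inr (.inr ⟨h, by simp⟩)
      · rintro (⟨h, hw⟩ | ⟨h, h' | ⟨j, hj, hw⟩⟩ | ⟨h, _⟩)
        · exact ⟨_, .inl ⟨h, rfl⟩, ih.2 hw⟩
        · simp at h'
        · obtain rfl : (i : ℕ) = j := by simpa using hj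
          exact ⟨_, .inr (.inl ⟨h, rfl⟩), ih.2 hw⟩
        · exact ⟨_, .inr (.inr ⟨h, rfl⟩), accepts_sink w⟩

theorem accepts_scan {o : Option S} {w : List (S × 𝔸)} :
    (D.errorAutomaton n).Accepts (.inl (scan o), μ) w ↔ D.Err n o w := by
  induction w generalizing o with
  | nil => simp [accepts_nil, errorAutomaton, fixedFinal, Err, mem_listIf]
  | cons b w ih =>
    simp only [accepts_cons, step_scan, Err, ← accepts_dup (n := n), ← accepts_lost (n := n), ← ih]
    constructor
    · rintro ⟨d, ⟨h, rfl⟩ | rfl | ⟨h, rfl⟩ | ⟨h, rfl⟩ | ⟨h, rfl⟩, hw⟩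
      · exact .inl h
      · exact .inr (.inr (.inr (.inr hw)))
      · exact .inr (.inl ⟨h, hw⟩)
      · exact .inr (.inr (.inl ⟨h, hw⟩))
      · exact .inr (.inr (.inr (.inl ⟨h, accepts_count.1 hw⟩)))
    · rintro (h | ⟨h, hw⟩ | ⟨h, hw⟩ | ⟨h, hw⟩ | hw)
      · exact ⟨_, .inl ⟨h, rfl⟩, accepts_sink w⟩
      · exact ⟨_, .inr (.inr (.inl ⟨h, rfl⟩)), hw⟩
      · exact ⟨_, .inr (.inr (.inr (.inl ⟨h, rfl⟩))), hw⟩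
      · exact ⟨_, .inr (.inr (.inr (.inr ⟨h, rfl⟩))), accepts_count.2 (by simpa using hw)⟩
      · exact ⟨_, .inr (.inl rfl), hw⟩

theorem mem_language_errorAutomaton {w : List (S × 𝔸)} :
    w ∈ (D.errorAutomaton n).language 𝔸 ↔ D.Err n none w := by
  rw [mem_language, ← accepts_scan (μ := fun _ => none)]
  simp [errorAutomaton]

/-- The contents of the register originate from the previous or the current block. -/
def Tracked (r : List 𝔸 × List 𝔸) (c : (ErrorLocation S ⊕ Fin (n + 1)) × (Fin 1 → Option 𝔸)) :
    Prop :=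
  match c.1 with
  | .inl (scan _) | .inr _ => c.2 = fun _ => none
  | .inl dup | .inl (lost _) => ∃ a ∈ r.2, c.2 = fun _ => some a
  | .inl (miss _) => ∃ a ∈ r.1, c.2 = fun _ => some a
  | .inl sink => True

/-- The locations `dup` and `lost` hold an atom of the current block. Passing a separator changes
`lost` to `miss` just when the current block becomes the previous one; a further separator leads to
`sink`. By `hneed`, the atom stored for `lost` is never that of a separator. Nothing is claimed
about `sink`, from where every continuation is accepted. -/
theorem Tracked.step (hneed : ∀ σ, D.need σ → ¬ D.sep σ) {r : List 𝔸 × List 𝔸}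
    {c d : (ErrorLocation S ⊕ Fin (n + 1)) × (Fin 1 → Option 𝔸)} {b : S × 𝔸}
    (hc : Tracked r c) (hs : (D.errorAutomaton n).Step c b d) : Tracked (D.advance r b) d := by
  obtain ⟨q, μ⟩ := c
  rcases q with (o | _ | σ | σ | _) | i
  · obtain rfl : μ = fun _ => none := hc
    rcases step_scan.1 hs with ⟨-, rfl⟩ | rfl | ⟨h, rfl⟩ | ⟨h, rfl⟩ | ⟨-, rfl⟩
    · trivial
    · rfl
    · exact ⟨b.2, by simp [advance, h], rfl⟩
    · exact ⟨b.2, by simp [advance, hneed _ h], rfl⟩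
    · rfl
  · obtain ⟨e, he, rfl⟩ : ∃ e ∈ r.2, μ = fun _ => some e := hc
    rcases step_dup.1 hs with ⟨-, -, rfl⟩ | ⟨h, rfl⟩
    · trivial
    · exact ⟨e, by simp [advance, h, he], rfl⟩
  · obtain ⟨e, he, rfl⟩ : ∃ e ∈ r.2, μ = fun _ => some e := hc
    rcases step_lost.1 hs with ⟨h, rfl⟩ | ⟨h, rfl⟩
    · exact ⟨e, by simp [advance, h, he], rfl⟩
    · exact ⟨e, by simp [advance, h, he], rfl⟩
  · obtain ⟨e, he, rfl⟩ : ∃ e ∈ r.1, μ = fun _ => some e := hc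
    rcases step_miss.1 hs with ⟨h, rfl⟩ | ⟨h, -, rfl⟩
    · trivial
    · exact ⟨e, by simp [advance, h, he], rfl⟩
  · rw [step_sink.1 hs]
    trivial
  · obtain rfl : μ = fun _ => none := hc
    refine Fin.cases (fun hs => ?_) (fun i hs => ?_) i hs
    · rcases step_count_zero.1 hs with ⟨-, rfl⟩ | ⟨-, rfl⟩
      · rfl
      · trivial
    · rcases step_count_succ.1 hs with ⟨-, rfl⟩ | ⟨-, rfl⟩ | ⟨-, rfl⟩
      · rfl
      · rfl
      · trivial

theorem Tracked.run (hneed : ∀ σ, D.need σ → ¬ D.sep σ) {w : List (S × 𝔸)} {r : List 𝔸 × List 𝔸}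
    {c d : (ErrorLocation S ⊕ Fin (n + 1)) × (Fin 1 → Option 𝔸)}
    (hc : Tracked r c) (h : (D.errorAutomaton n).Run c w d) :
    Tracked (w.foldl D.advance r) d := by
  induction w generalizing r c with
  | nil => exact run_nil_iff.1 h ▸ hc
  | cons b w ih =>
    obtain ⟨e, he, h⟩ := run_cons_iff.1 h
    exact ih (hc.step hneed he) h

/-- The language of the automaton is deterministic if all words outside of it have blocks of
bounded length. -/
theorem isDRALanguage_errorAutomaton [Nonempty 𝔸] (hneed : ∀ σ, D.need σ → ¬ D.sep σ) (K : ℕ)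
    (hK : ∀ w : List (S × 𝔸), ¬ D.Err n none w → D.BlocksLE K 0 w) :
    IsDRALanguage ((D.errorAutomaton n).language 𝔸) := by
  classical
  -- At most `K` atoms from each of the previous and the current block.
  refine isDRALanguage_of_bounded (K + K) fun u => or_iff_not_imp_left.2 fun hu => ?_
  push Not at hu
  obtain ⟨v, hv⟩ := hu
  obtain ⟨h₁, h₂⟩ := BlocksLE.foldl_advance (r := ([], []))
    (hK _ (mt mem_language_errorAutomaton.2 hv)) (Nat.zero_le _)
  set r := u.foldl D.advance ([], []) with hr
  refine ⟨(r.1 ++ r.2).toFinset, (List.toFinset_card_le _).trans (by simp; omega), ?_⟩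
  rintro d ⟨p, hp, hd⟩ x e hx
  have hp' : p = .inl (scan none) := by simpa [errorAutomaton] using hp
  subst hp'
  have ht := Tracked.run hneed (r := ([], [])) (show Tracked ([], [])
    ((.inl (scan none), fun _ => none) : (ErrorLocation S ⊕ Fin (n + 1)) × (Fin 1 → Option 𝔸)) from
    rfl) hd
  rw [← hr] at ht
  obtain ⟨q, μ⟩ := d
  rcases q with (o | _ | σ | σ | _) | i
  · obtain rfl : μ = fun _ => none := ht
    cases hx
  · obtain ⟨e, he, rfl⟩ : ∃ e ∈ r.2, μ = fun _ => some e := ht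
    cases hx
    simp [he]
  · obtain ⟨e, he, rfl⟩ : ∃ e ∈ r.2, μ = fun _ => some e := ht
    cases hx
    simp [he]
  · obtain ⟨e, he, rfl⟩ : ∃ e ∈ r.1, μ = fun _ => some e := ht
    cases hx
    simp [he]
  -- A prefix that reaches `sink` has no continuation outside the language, contrary to the choice
  -- of `v`.
  · exact absurd (mem_language.2 ⟨_, hp, accepts_append.2 ⟨_, hd, accepts_sink v⟩⟩) hv
  · obtain rfl : μ = fun _ => none := ht
    cases hx

end BlockDiscipline

/-! ### Encoding of computations by sequences of blocks -/

/-- The kinds of blocks in encodings of computations of counter machines: repeated rounds consist of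
a `reset`, a number of `load`s and steps of the machine. The Boolean value at a step indicates
whether a counter is decremented. -/
inductive BlockKind (Λ : Type) : Type where
  | reset : BlockKind Λ
  | load : BlockKind Λ
  | fin : BlockKind Λ
  | step (q : Λ) (b : Bool) : BlockKind Λ

instance {Λ : Type} [Finite Λ] : Finite (BlockKind Λ) := by
  refine Finite.of_injective (β := Option (Option (Option (Λ × Bool)))) (fun
    | .reset => none
    | .load => some none
    | .fin => some (some none)
    | .step q b => some (some (some (q, b)))) ?_
  rintro (_ | _ | _ | _) (_ | _ | _ | _) h <;> simp_all

/-- The labels of atoms: an atom is free, or it is wasted, or it contributes to a counter. -/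
abbrev CellLabel (C : Type) : Type := Option (Option C)

/-- The label of free atoms. -/
abbrev CellLabel.free {C : Type} : CellLabel C := none

/-- The label of wasted atoms. -/
abbrev CellLabel.waste {C : Type} : CellLabel C := some none

/-- The label of atoms contributing to a counter. -/
abbrev CellLabel.ctr {C : Type} (c : C) : CellLabel C := some (some c)

/-- The symbols of the encoding. In every block, a separator is followed by cells; the first cell is
marked by `true`. -/
abbrev Letter (Λ C : Type) : Type := BlockKind Λ × Option (Bool × CellLabel C)

section Encoding

open BlockKind CellLabel

variable {Λ C : Type} (M : Λ → CounterInstruction Λ C) (q₀ : Λ) (c₀ : C)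

/-- The location after a step. -/
def nextLocation (q : Λ) (b : Bool) : Λ :=
  match M q with
  | .halt => q
  | .nop p => p
  | .inc _ p => p
  | .dec _ p r => if b then r else p

/-- The kinds of blocks that may succeed each other. -/
def Follows : BlockKind Λ → BlockKind Λ → Prop
  | fin, _ => False
  | step q b, t => t = reset ∨ ∃ b', t = step (nextLocation M q b) b'
  | _, t => t = reset ∨ t = load ∨ t = fin ∨ ∃ b', t = step q₀ b'

/-- The admissible labels of the first cell of a block. -/
def HeadOK : BlockKind Λ → CellLabel C → Prop
  | reset, l => l ≠ free
  | load, l => l = free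
  | fin, _ => False
  | step q b, l => match M q with
    | .halt => False
    | .nop _ => l = free
    | .inc _ _ => l = free
    | .dec c _ _ => if b then l = ctr c else l = free

/-- The admissible labels of the other cells of a block. -/
def RestOK : BlockKind Λ → CellLabel C → Prop
  | reset, l => l ≠ free
  | load, _ => True
  | fin, _ => False
  | step q b, l => match M q with
    | .dec c _ _ => b = false → l ≠ ctr c
    | _ => True

/-- The label that the atom of the first cell has in the next block, if it is required to occur
there. -/
def headNext : BlockKind Λ → Option (CellLabel C)
  | reset => none
  | load => some (ctr c₀)
  | fin => none
  | step q _ => match M q with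
    | .inc c _ => some (ctr c)
    | _ => some waste

/-- The label that the atom of another cell has in the next block. -/
def restNext : BlockKind Λ → CellLabel C → CellLabel C
  | reset, _ => free
  | _, l => l

/-- The label that the atom at a symbol has in the next block. -/
def nextLabel : Letter Λ C → Option (CellLabel C)
  | (_, none) => none
  | (t, some (true, _)) => headNext M c₀ t
  | (t, some (false, l)) => some (restNext t l)

/-- The conditions on pairs of adjacent symbols. -/
def Adjacent : Option (Letter Λ C) → Letter Λ C → Prop
  | none, (t, none) => t = reset
  | some (t, none), (t', some (true, l)) => t' = t ∧ HeadOK M t l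
  | some (t, some _), (t', none) => Follows M q₀ t t'
  | some (t, some _), (t', some (false, l)) => t' = t ∧ RestOK M t l
  | _, _ => False

/-- The conditions on encodings of computations. -/
def machineDiscipline : BlockDiscipline (Letter Λ C) where
  sep σ := σ.2 = none
  adj := Adjacent M q₀
  accept o := o = some (fin, none)
  need σ := nextLabel M c₀ σ ≠ none
  mat σ τ := ∃ b l, τ.2 = some (b, l) ∧ nextLabel M c₀ σ = some l
  reset σ := σ = (reset, none)
  load σ := σ = (load, none)
  step σ := ∃ q b, σ = (step q b, none)

theorem not_sep_of_need (σ : Letter Λ C) (h : (machineDiscipline M q₀ c₀).need σ) :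
    ¬ (machineDiscipline M q₀ c₀).sep σ := by
  rintro h'
  obtain ⟨t, k⟩ := σ
  obtain rfl : k = none := h'
  exact h rfl

/-- A block: its kind, the atom at the separator, and the labels and atoms of the cells. -/
structure Block (Λ C 𝔸 : Type) where
  kind : BlockKind Λ
  atom : 𝔸
  cells : List (CellLabel C × 𝔸)

variable {𝔸 : Type}

/-- The word consisting of cells that do not begin a block. -/
def restWord (t : BlockKind Λ) (cs : List (CellLabel C × 𝔸)) : List (Letter Λ C × 𝔸) :=
  cs.map fun c => ((t, some (false, c.1)), c.2)

/-- The word consisting of all cells of a block. -/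
def cellsWord (t : BlockKind Λ) : List (CellLabel C × 𝔸) → List (Letter Λ C × 𝔸)
  | [] => []
  | c :: cs => ((t, some (true, c.1)), c.2) :: restWord t cs

/-- The word encoding a sequence of blocks. -/
def blocksWord : List (Block Λ C 𝔸) → List (Letter Λ C × 𝔸)
  | [] => []
  | b :: bs => ((b.kind, none), b.atom) :: (cellsWord b.kind b.cells ++ blocksWord bs)

/-- The labelled atoms that are required to occur in the next block. -/
def relabelled (t : BlockKind Λ) : List (CellLabel C × 𝔸) → List (CellLabel C × 𝔸)
  | [] => []
  | c :: cs => ((headNext M c₀ t).toList.map fun l => (l, c.2)) ++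
      cs.map fun c => (restNext t c.1, c.2)

/-- The conditions on a nonempty block. -/
def BlockOK (t : BlockKind Λ) : List (CellLabel C × 𝔸) → Prop
  | [] => False
  | c :: cs => HeadOK M t c.1 ∧ (∀ d ∈ cs, RestOK M t d.1) ∧ (c.2 :: cs.map Prod.snd).Nodup

/-- The conditions on sequences of blocks. -/
def ValidBlocks (n : ℕ) : List (Block Λ C 𝔸) → Prop
  | [] => False
  | [b] => b.kind = fin ∧ b.cells = []
  | b :: b' :: bs => BlockOK M b.kind b.cells ∧ Follows M q₀ b.kind b'.kind ∧
      relabelled M c₀ b.kind b.cells ⊆ b'.cells ∧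
      (b.kind = reset → ¬ (machineDiscipline M q₀ c₀).Miscount n (blocksWord (b' :: bs))) ∧
      ValidBlocks n (b' :: bs)

variable {M q₀ c₀}

/-- The word is empty or begins with a separator. -/
def AtBoundary (w : List (Letter Λ C × 𝔸)) : Prop := ∀ b ∈ w.head?, b.1.2 = none

theorem atBoundary_blocksWord (bs : List (Block Λ C 𝔸)) : AtBoundary (blocksWord bs) := by
  cases bs <;> simp [AtBoundary, blocksWord]

theorem dup_restWord {t : BlockKind Λ} {cs : List (CellLabel C × 𝔸)} {w : List (Letter Λ C × 𝔸)}
    (hw : AtBoundary w) {a : 𝔸} : (machineDiscipline M q₀ c₀).Dup a (restWord t cs ++ w) ↔ a ∈ cs.map Prod.snd := by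
  induction cs with
  | nil =>
    cases w with
    | nil => simp [restWord, BlockDiscipline.Dup]
    | cons b w => simp [restWord, BlockDiscipline.Dup, machineDiscipline, hw b rfl]
  | cons c cs ih =>
    simp only [restWord, List.map_cons, List.cons_append, BlockDiscipline.Dup] at ih ⊢
    rw [ih]
    simp [machineDiscipline, eq_comm]

theorem lost_restWord {t : BlockKind Λ} {cs : List (CellLabel C × 𝔸)} {w : List (Letter Λ C × 𝔸)}
    {σ : Letter Λ C} {a : 𝔸} : (machineDiscipline M q₀ c₀).Lost σ a (restWord t cs ++ w) ↔ (machineDiscipline M q₀ c₀).Lost σ a w := by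
  induction cs with
  | nil => rfl
  | cons c cs ih =>
    simp only [restWord, List.map_cons, List.cons_append, BlockDiscipline.Lost] at ih ⊢
    rw [ih]
    simp [machineDiscipline]

theorem miscount_restWord {t : BlockKind Λ} {cs : List (CellLabel C × 𝔸)}
    {w : List (Letter Λ C × 𝔸)} {r : ℕ} : (machineDiscipline M q₀ c₀).Miscount r (restWord t cs ++ w) ↔ (machineDiscipline M q₀ c₀).Miscount r w := by
  induction cs with
  | nil => rfl
  | cons c cs ih =>
    simp only [restWord, List.map_cons, List.cons_append, BlockDiscipline.Miscount] at ih ⊢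
    rw [ih]
    simp [machineDiscipline]

theorem miscount_cellsWord {t : BlockKind Λ} {cs : List (CellLabel C × 𝔸)}
    {w : List (Letter Λ C × 𝔸)} {r : ℕ} : (machineDiscipline M q₀ c₀).Miscount r (cellsWord t cs ++ w) ↔ (machineDiscipline M q₀ c₀).Miscount r w := by
  cases cs with
  | nil => rfl
  | cons c cs =>
    simp only [cellsWord, List.cons_append, BlockDiscipline.Miscount, miscount_restWord]
    simp [machineDiscipline]

/-- Cells are skipped. A `reset` or `fin` ends the count without a violation, because a round may be
cut short when the free atoms run out before all loads are done. -/
theorem miscount_blocksWord_cons {b : Block Λ C 𝔸} {bs : List (Block Λ C 𝔸)} {r : ℕ} :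
    (machineDiscipline M q₀ c₀).Miscount r (blocksWord (b :: bs)) ↔
      (b.kind = load ∧ (r = 0 ∨ ∃ i, r = i + 1 ∧ (machineDiscipline M q₀ c₀).Miscount i (blocksWord bs))) ∨
      ((∃ q b', b.kind = step q b') ∧ r ≠ 0) := by
  simp only [blocksWord, BlockDiscipline.Miscount, miscount_cellsWord]
  simp [machineDiscipline]

theorem not_miss_restWord {t : BlockKind Λ} {cs : List (CellLabel C × 𝔸)}
    {w : List (Letter Λ C × 𝔸)} (hw : AtBoundary w) {σ : Letter Λ C} {a : 𝔸} :
    ¬ (machineDiscipline M q₀ c₀).Miss σ a (restWord t cs ++ w) ↔ ∃ l, nextLabel M c₀ σ = some l ∧ (l, a) ∈ cs := by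
  induction cs with
  | nil =>
    cases w with
    | nil => simp [restWord, BlockDiscipline.Miss]
    | cons b w => simp [restWord, BlockDiscipline.Miss, machineDiscipline, hw b rfl]
  | cons c cs ih =>
    simp only [restWord, List.map_cons, List.cons_append, BlockDiscipline.Miss] at ih ⊢
    rw [not_or, not_and, not_and, ih]
    obtain ⟨l', a'⟩ := c
    simp only [machineDiscipline, reduceCtorEq, not_false_eq_true, true_and, forall_const,
      Option.some.injEq, Prod.mk.injEq, List.mem_cons]
    constructor
    · intro h
      by_cases hm : (∃ b l, (false = b ∧ l' = l) ∧ nextLabel M c₀ σ = some l) ∧ a' = a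
      · obtain ⟨⟨_, _, ⟨-, rfl⟩, hl⟩, rfl⟩ := hm
        exact ⟨_, hl, .inl ⟨rfl, rfl⟩⟩
      · obtain ⟨l, hl, hc⟩ := h hm
        exact ⟨l, hl, .inr hc⟩
    · rintro ⟨l, hl, ⟨rfl, rfl⟩ | hc⟩ h
      · exact absurd ⟨⟨false, _, ⟨rfl, rfl⟩, hl⟩, rfl⟩ h
      · exact ⟨l, hl, hc⟩

theorem not_miss_cellsWord {t : BlockKind Λ} {cs : List (CellLabel C × 𝔸)}
    {w : List (Letter Λ C × 𝔸)} (hw : AtBoundary w) {σ : Letter Λ C} {a : 𝔸} :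
    ¬ (machineDiscipline M q₀ c₀).Miss σ a (cellsWord t cs ++ w) ↔ ∃ l, nextLabel M c₀ σ = some l ∧ (l, a) ∈ cs := by
  cases cs with
  | nil => exact not_miss_restWord (t := t) (cs := []) hw
  | cons c cs =>
    rw [← not_miss_restWord (q₀ := q₀) (t := t) hw]
    simp [cellsWord, restWord, BlockDiscipline.Miss, machineDiscipline]

/-- `Lost` proceeds to the separator of `b`, and `Miss` stops at the next separator, so exactly the
cells of `b` are searched. -/
theorem not_lost_blocksWord {b : Block Λ C 𝔸} {bs : List (Block Λ C 𝔸)} {σ : Letter Λ C} {a : 𝔸} :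
    ¬ (machineDiscipline M q₀ c₀).Lost σ a (blocksWord (b :: bs)) ↔ ∃ l, nextLabel M c₀ σ = some l ∧ (l, a) ∈ b.cells := by
  rw [← not_miss_cellsWord (q₀ := q₀) (t := b.kind) (atBoundary_blocksWord bs)]
  simp [blocksWord, BlockDiscipline.Lost, machineDiscipline]

/-- After a cell, the adjacency conditions depend only on the kind of its block. This lets the
preceding cell be exchanged in the induction over the cells of a block. -/
theorem err_cell_congr {n : ℕ} {t : BlockKind Λ} {k k' : Bool × CellLabel C}
    {w : List (Letter Λ C × 𝔸)} : (machineDiscipline M q₀ c₀).Err n (some (t, some k)) w ↔ (machineDiscipline M q₀ c₀).Err n (some (t, some k')) w := by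
  cases w with
  | nil => simp [BlockDiscipline.Err, machineDiscipline]
  | cons b w =>
    have : (machineDiscipline M q₀ c₀).adj (some (t, some k)) b.1 ↔ (machineDiscipline M q₀ c₀).adj (some (t, some k')) b.1 := by
      obtain ⟨⟨t', _ | ⟨_ | _, l⟩⟩, a⟩ := b <;> rfl
    simp only [BlockDiscipline.Err, this]

theorem not_err_restWord {n : ℕ} {t : BlockKind Λ} {k : Bool × CellLabel C}
    {cs : List (CellLabel C × 𝔸)} {w : List (Letter Λ C × 𝔸)} (hw : AtBoundary w) :
    ¬ (machineDiscipline M q₀ c₀).Err n (some (t, some k)) (restWord t cs ++ w) ↔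
      (∀ d ∈ cs, RestOK M t d.1) ∧ (cs.map Prod.snd).Nodup ∧
      (∀ d ∈ cs, ¬ (machineDiscipline M q₀ c₀).Lost (t, some (false, d.1)) d.2 w) ∧ ¬ (machineDiscipline M q₀ c₀).Err n (some (t, some k)) w := by
  induction cs generalizing k with
  | nil => simp [restWord]
  | cons c cs ih =>
    have hcons : restWord t (c :: cs) ++ w =
        ((t, some (false, c.1)), c.2) :: (restWord t cs ++ w) := rfl
    rw [hcons]
    simp only [BlockDiscipline.Err, not_or, ih, dup_restWord hw, lost_restWord,
      err_cell_congr (k := (false, c.1)) (k' := k)]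
    simp only [machineDiscipline, Adjacent, nextLabel, List.forall_mem_cons, List.map_cons,
      List.nodup_cons]
    simp
    tauto

theorem not_err_cellsWord {n : ℕ} {t : BlockKind Λ} {c : CellLabel C × 𝔸}
    {cs : List (CellLabel C × 𝔸)} {w : List (Letter Λ C × 𝔸)} (hw : AtBoundary w) :
    ¬ (machineDiscipline M q₀ c₀).Err n (some (t, none)) (cellsWord t (c :: cs) ++ w) ↔
      BlockOK M t (c :: cs) ∧ (headNext M c₀ t ≠ none → ¬ (machineDiscipline M q₀ c₀).Lost (t, some (true, c.1)) c.2 w) ∧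
      (∀ d ∈ cs, ¬ (machineDiscipline M q₀ c₀).Lost (t, some (false, d.1)) d.2 w) ∧
      ¬ (machineDiscipline M q₀ c₀).Err n (some (t, some (true, c.1))) w := by
  simp only [cellsWord, List.cons_append, BlockDiscipline.Err, not_or, not_err_restWord hw,
    dup_restWord hw, lost_restWord, BlockOK, List.nodup_cons]
  simp only [machineDiscipline, Adjacent, nextLabel]
  simp
  tauto

theorem not_err_separator {n : ℕ} {t t' : BlockKind Λ} {k : Bool × CellLabel C} {a : 𝔸}
    {w : List (Letter Λ C × 𝔸)} :
    ¬ (machineDiscipline M q₀ c₀).Err n (some (t, some k)) (((t', none), a) :: w) ↔ Follows M q₀ t t' ∧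
      (t' = reset → ¬ (machineDiscipline M q₀ c₀).Miscount n w) ∧ ¬ (machineDiscipline M q₀ c₀).Err n (some (t', none)) w := by
  simp only [BlockDiscipline.Err, not_or]
  simp [machineDiscipline, Adjacent, nextLabel]

/-- Words without errors are sequences of blocks. -/
theorem exists_blocks {n : ℕ} {w : List (Letter Λ C × 𝔸)} {t : BlockKind Λ}
    {k : Option (Bool × CellLabel C)} (h : ¬ (machineDiscipline M q₀ c₀).Err n (some (t, k)) w) :
    (k = none → ∃ cs bs, w = cellsWord t cs ++ blocksWord bs) ∧
    (k ≠ none → ∃ cs bs, w = restWord t cs ++ blocksWord bs) := by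
  induction w generalizing t k with
  | nil => exact ⟨fun _ => ⟨[], [], rfl⟩, fun _ => ⟨[], [], rfl⟩⟩
  | cons b w ih =>
    simp only [BlockDiscipline.Err, not_or, not_not] at h
    obtain ⟨hadj, -, -, -, h⟩ := h
    obtain ⟨⟨t', k'⟩, a⟩ := b
    have h' := ih h
    rcases k' with _ | ⟨_ | _, l⟩
    · obtain ⟨cs, bs, rfl⟩ := h'.1 rfl
      refine ⟨fun hk => ?_, fun _ => ⟨[], ⟨t', a, cs⟩ :: bs, rfl⟩⟩
      subst hk
      exact hadj.elim
    · obtain ⟨cs, bs, rfl⟩ := h'.2 (by simp)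
      rcases k with _ | k
      · exact hadj.elim
      · obtain rfl : t' = t := hadj.1
        exact ⟨by simp, fun _ => ⟨(l, a) :: cs, bs, rfl⟩⟩
    · obtain ⟨cs, bs, rfl⟩ := h'.2 (by simp)
      rcases k with _ | k
      · obtain rfl : t' = t := hadj.1
        exact ⟨fun _ => ⟨(l, a) :: cs, bs, rfl⟩, by simp⟩
      · exact hadj.elim

/-- The conditions on words and those on blocks agree. -/
theorem not_err_iff_validBlocks {n : ℕ} {b : Block Λ C 𝔸} {bs : List (Block Λ C 𝔸)} :
    (¬ (machineDiscipline M q₀ c₀).Err n (some (b.kind, none)) (cellsWord b.kind b.cells ++ blocksWord bs) ∧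
      (b.kind = reset → ¬ (machineDiscipline M q₀ c₀).Miscount n (blocksWord bs))) ↔ ValidBlocks M q₀ c₀ n (b :: bs) := by
  induction bs generalizing b with
  | nil =>
    obtain ⟨t, x, _ | ⟨c, cs⟩⟩ := b
    · simp [cellsWord, blocksWord, BlockDiscipline.Err, ValidBlocks, machineDiscipline,
        BlockDiscipline.Miscount]
    · rw [not_err_cellsWord (atBoundary_blocksWord _)]
      simp [blocksWord, BlockDiscipline.Err, ValidBlocks, machineDiscipline]
  | cons b' bs ih =>
    obtain ⟨t, x, _ | ⟨c, cs⟩⟩ := b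
    · simp [cellsWord, blocksWord, BlockDiscipline.Err, ValidBlocks, machineDiscipline, BlockOK,
        Adjacent]
    · rw [not_err_cellsWord (atBoundary_blocksWord _)]
      simp only [ValidBlocks, ← ih, not_lost_blocksWord]
      have hs : relabelled M c₀ t (c :: cs) ⊆ b'.cells ↔
          (headNext M c₀ t ≠ none → ∃ l, nextLabel M c₀ (t, some (true, c.1)) = some l ∧
            (l, c.2) ∈ b'.cells) ∧
          ∀ d ∈ cs, ∃ l, nextLabel M c₀ (t, some (false, d.1)) = some l ∧ (l, d.2) ∈ b'.cells := by
        simp only [relabelled, nextLabel, List.append_subset]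
        refine and_congr ?_ ?_
        · cases headNext M c₀ t <;> simp
        · simp [List.subset_def]
          grind
      rw [hs]
      simp only [blocksWord, not_err_separator, miscount_cellsWord]
      tauto

end Encoding

/-! ### Halting computations bound the blocks -/

section Encoding

open BlockKind CellLabel

variable {Λ C 𝔸 : Type} {M : Λ → CounterInstruction Λ C} {q₀ : Λ} {c₀ : C} {n : ℕ}

theorem ValidBlocks.of_cons {b b' : Block Λ C 𝔸} {bs : List (Block Λ C 𝔸)}
    (h : ValidBlocks M q₀ c₀ n (b :: b' :: bs)) : ValidBlocks M q₀ c₀ n (b' :: bs) :=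
  h.2.2.2.2

theorem blocksLE_restWord {K r : ℕ} {t : BlockKind Λ} {cs : List (CellLabel C × 𝔸)}
    {bs : List (Block Λ C 𝔸)} (hr : r + cs.length ≤ K) (hbs : ∀ b ∈ bs, b.cells.length ≤ K) :
    (machineDiscipline M q₀ c₀).BlocksLE K r (restWord t cs ++ blocksWord bs) := by
  induction bs generalizing r t cs with
  | nil =>
    induction cs generalizing r with
    | nil => simpa [restWord, blocksWord, BlockDiscipline.BlocksLE] using hr
    | cons c cs ih =>
      rw [List.length_cons] at hr
      exact ⟨by omega, fun h => by simp [machineDiscipline] at h, fun _ => ih (by omega)⟩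
  | cons b bs ihb =>
    induction cs generalizing r with
    | nil =>
      refine ⟨by simpa using hr, fun _ => ?_, fun h => by simp [machineDiscipline] at h⟩
      have hb := hbs b (by simp)
      have hbs' : ∀ b ∈ bs, b.cells.length ≤ K := fun b h => hbs b (by simp [h])
      rcases hc : b.cells with _ | ⟨c, cs⟩
      · exact ihb (t := b.kind) (cs := []) (by simp) hbs'
      · rw [hc, List.length_cons] at hb
        exact ⟨by omega, fun h => by simp [machineDiscipline] at h,
          fun _ => ihb (by omega) hbs'⟩
    | cons c cs ih =>
      rw [List.length_cons] at hr
      exact ⟨by omega, fun h => by simp [machineDiscipline] at h, fun _ => ih (by omega)⟩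

theorem snd_relabelled (t : BlockKind Λ) (cs : List (CellLabel C × 𝔸)) :
    ((relabelled M c₀ t cs).map Prod.snd).Sublist (cs.map Prod.snd) := by
  cases cs with
  | nil => exact .slnil
  | cons c cs =>
    simp only [relabelled, List.map_append, List.map_map, Function.comp_def, List.map_cons]
    cases headNext M c₀ t <;> simp

theorem nodup_of_blockOK {t : BlockKind Λ} {cs : List (CellLabel C × 𝔸)} (h : BlockOK M t cs) :
    (cs.map Prod.snd).Nodup := by
  cases cs with
  | nil => exact h.elim
  | cons c cs => exact h.2.2

/-- As the atoms of a block are distinct, inclusion holds with multiplicities. Equal lengths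
therefore give a permutation, which means that no atom has been gained. -/
theorem subperm_of_valid {b b' : Block Λ C 𝔸} {bs : List (Block Λ C 𝔸)}
    (h : ValidBlocks M q₀ c₀ n (b :: b' :: bs)) :
    (relabelled M c₀ b.kind b.cells).Subperm b'.cells := by
  refine List.subperm_of_subset ?_ h.2.2.1
  exact List.Nodup.of_map Prod.snd ((snd_relabelled _ _).nodup (nodup_of_blockOK h.1))

/-- Only the head of a block may lack a successor, and only in a `reset`. -/
theorem length_relabelled {t : BlockKind Λ} {cs : List (CellLabel C × 𝔸)} (h : BlockOK M t cs) :
    cs.length ≤ (relabelled M c₀ t cs).length + 1 ∧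
      (t ≠ reset → (relabelled M c₀ t cs).length = cs.length) := by
  rcases cs with _ | ⟨c, cs⟩
  · exact h.elim
  cases t with
  | reset => simp [relabelled]
  | load => simp [relabelled, headNext]
  | fin => exact h.1.elim
  | step q e =>
    simp only [relabelled, headNext]
    split <;> simp

/-- The labels in a block represent a valuation of the counters. -/
def Represents [DecidableEq C] (cs : List (CellLabel C × 𝔸)) (σ : C → ℕ) : Prop :=
  ∀ c, (cs.map Prod.fst).count (ctr c) = σ c

variable [DecidableEq C]

/-- The number of free atoms in a block. -/
def freeCount (cs : List (CellLabel C × 𝔸)) : ℕ := (cs.map Prod.fst).count free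

theorem not_free_of_reset {cs : List (CellLabel C × 𝔸)} (h : BlockOK M reset cs) :
    freeCount cs = 0 := by
  cases cs with
  | nil => exact h.elim
  | cons c cs =>
    refine List.count_eq_zero.2 fun hm => ?_
    rw [List.map_cons, List.mem_cons] at hm
    rcases hm with hm | hm
    · exact h.1 hm.symm
    · obtain ⟨d, hd, hm⟩ := List.mem_map.1 hm
      exact h.2.1 d hd hm

/-- The effect of a step without gained atoms. -/
theorem step_exact {q : Λ} {e : Bool} {cs cs' : List (CellLabel C × 𝔸)} {σ : C → ℕ}
    (h : BlockOK M (step q e) cs) (hσ : Represents cs σ)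
    (hp : (relabelled M c₀ (step q e) cs).Perm cs') :
    ∃ τ, (M q).exec σ = some (nextLocation M q e, τ) ∧ Represents cs' τ ∧
      freeCount cs ≤ freeCount cs' + 1 := by
  rcases cs with _ | ⟨⟨l, a⟩, cs⟩
  · exact h.elim
  obtain ⟨hl, hcs, -⟩ := h
  have hcount : ∀ x, (cs'.map Prod.fst).count x =
      ((headNext M c₀ (step q e)).toList ++ cs.map Prod.fst).count x := by
    intro x
    rw [← (hp.map Prod.fst).count_eq]
    congr 1
    simp [relabelled, restNext, Function.comp_def]
  simp only [Represents, freeCount, hcount, List.map_cons, headNext] at hσ ⊢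
  simp only [HeadOK, RestOK] at hl hcs
  simp only [nextLocation]
  cases hM : M q with
  | halt => simp [hM] at hl
  | nop p =>
    simp only [hM] at hl ⊢
    subst hl
    refine ⟨σ, rfl, fun c => ?_, ?_⟩
    · simpa [List.count_cons] using hσ c
    · simp
  | inc c p =>
    simp only [hM] at hl ⊢
    subst hl
    refine ⟨_, rfl, fun c' => ?_, ?_⟩
    · have := hσ c'
      by_cases hc : c' = c
      · subst hc
        simp at this ⊢
        exact this
      · simp [hc, Ne.symm hc] at this ⊢
        exact this
    · simp
  | dec c p r =>
    simp only [hM] at hl hcs ⊢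
    cases e with
    | true =>
      simp only [if_true] at hl ⊢
      subst hl
      have hc := hσ c
      simp only [List.count_cons, beq_self_eq_true, if_true] at hc
      have h0 : σ c ≠ 0 := by omega
      refine ⟨Function.update σ c (σ c - 1), by simp [CounterInstruction.exec, h0], fun c' => ?_, ?_⟩
      · have := hσ c'
        by_cases hc' : c' = c
        · subst hc'
          simp at this ⊢
          omega
        · simp [hc', Ne.symm hc'] at this ⊢
          exact this
      · simp
    | false =>
      simp only [Bool.false_eq_true, if_false, forall_const] at hl hcs ⊢
      subst hl
      -- The zero branch admits no cell labelled by `c`: the head is free, and `RestOK` forbids the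
      -- label for all others.
      have h0 : σ c = 0 := by
        rw [← hσ c]
        refine List.count_eq_zero.2 fun hm => ?_
        rw [List.mem_cons] at hm
        rcases hm with hm | hm
        · simp at hm
        · obtain ⟨d, hd, hm⟩ := List.mem_map.1 hm
          exact hcs d hd hm
      refine ⟨σ, by simp [CounterInstruction.exec, h0], fun c' => ?_, ?_⟩
      · simpa [List.count_cons] using hσ c'
      · simp

/-- The effect of a load without gained atoms. -/
theorem load_exact {cs cs' : List (CellLabel C × 𝔸)} {r : ℕ}
    (h : BlockOK M load cs) (hσ : Represents cs (Function.update 0 c₀ r))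
    (hp : (relabelled M c₀ load cs).Perm cs') :
    Represents cs' (Function.update 0 c₀ (r + 1)) ∧ freeCount cs = freeCount cs' + 1 := by
  rcases cs with _ | ⟨⟨l, a⟩, cs⟩
  · exact h.elim
  obtain ⟨hl, -⟩ := h
  obtain rfl : l = free := hl
  have hcount : ∀ x, (cs'.map Prod.fst).count x = (ctr c₀ :: cs.map Prod.fst).count x := by
    intro x
    rw [← (hp.map Prod.fst).count_eq]
    congr 1
    simp [relabelled, restNext, headNext]
  simp only [Represents, freeCount, hcount, List.map_cons] at hσ ⊢
  refine ⟨fun c => ?_, ?_⟩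
  · have := hσ c
    by_cases hc : c = c₀
    · subst hc
      simp at this ⊢
      exact this
    · simp [hc, Ne.symm hc] at this ⊢
      exact this
  · simp

/-- If the machine halts, then a sequence of blocks cannot have large blocks. -/
theorem no_large_block {j : ℕ} (hj : HaltsIn M j (q₀, Function.update 0 c₀ n))
    {bs : List (Block Λ C 𝔸)} : ∀ b, ValidBlocks M q₀ c₀ n (b :: bs) →
    b.cells.length ≤ j + n + 1 ∧ (j + n + 1 ≤ b.cells.length →
      (∀ q σ i, (b.kind = reset ∨ ∃ e, b.kind = step q e) → HaltsIn M i (q, σ) →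
        i < freeCount b.cells → ¬ Represents b.cells σ) ∧
      (∀ i r, (b.kind = reset ∨ b.kind = load ∨ b.kind = fin ∨ ∃ e, b.kind = step q₀ e) →
        ¬ (machineDiscipline M q₀ c₀).Miscount r (blocksWord (b :: bs)) → i + r = n →
        j + r < freeCount b.cells → ¬ Represents b.cells (Function.update 0 c₀ i))) := by
  induction bs with
  | nil =>
    rintro b ⟨hk, hb⟩
    simp [hb]
  | cons b' bs ih =>
    intro b h
    obtain ⟨ih₁, ih₂⟩ := ih b' h.of_cons
    have hsub := subperm_of_valid h
    obtain ⟨hlen, hlen'⟩ := length_relabelled (c₀ := c₀) h.1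
    have hfol := h.2.1
    have hle := hsub.length_le
    have hrun : j + n + 1 ≤ b.cells.length →
      (∀ q σ i, (b.kind = reset ∨ ∃ e, b.kind = step q e) → HaltsIn M i (q, σ) →
        i < freeCount b.cells → ¬ Represents b.cells σ) := by
      intro hb q σ i hk hi hif hσ
      rcases hk with hk | ⟨e, hk⟩
      -- A reset requires that the free atoms are exhausted.
      · have := not_free_of_reset (hk ▸ h.1)
        omega
      · have hl := hlen' (by simp [hk])
        -- The next block is at least as long as this one and at most `j + n + 1` by induction, so
        -- it has no additional atoms.
        have hperm := hsub.perm_of_length_le (by omega)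
        rw [hk] at hperm hfol
        obtain ⟨τ, hτ, hrep, hfree⟩ := step_exact (hk ▸ h.1) hσ hperm
        cases hi with
        -- No step block is admissible at a halting location.
        | halt h0 => rw [h0] at hτ; cases hτ
        | step h1 hd =>
          rw [h1] at hτ
          obtain rfl := Option.some.inj hτ
          exact (ih₂ (by omega)).1 _ _ _ hfol hd (by omega) hrep
    have hload : j + n + 1 ≤ b.cells.length →
      (∀ i r, (b.kind = reset ∨ b.kind = load ∨ b.kind = fin ∨ ∃ e, b.kind = step q₀ e) →
        ¬ (machineDiscipline M q₀ c₀).Miscount r (blocksWord (b :: b' :: bs)) → i + r = n →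
        j + r < freeCount b.cells → ¬ Represents b.cells (Function.update 0 c₀ i)) := by
      intro hb i r hk hm hir hf hrep
      rw [miscount_blocksWord_cons] at hm
      push Not at hm
      rcases hk with hk | hk | hk | ⟨e, hk⟩
      · have := not_free_of_reset (hk ▸ h.1)
        omega
      · have hl := hlen' (by simp [hk])
        have hperm := hsub.perm_of_length_le (by omega)
        rw [hk] at hperm hfol
        obtain ⟨hrep', hfree⟩ := load_exact (hk ▸ h.1) hrep hperm
        obtain ⟨hr0, hr⟩ := hm.1 hk
        obtain ⟨r, rfl⟩ := Nat.exists_eq_succ_of_ne_zero hr0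
        exact (ih₂ (by omega)).2 (i + 1) r hfol (hr r rfl) (by omega) (by omega) hrep'
      · rw [hk] at hfol
        exact hfol
      -- A step may only begin when no load is outstanding, so the counter `c₀` contains exactly
      -- `n`.
      · obtain rfl := hm.2 ⟨q₀, e, hk⟩
        obtain rfl : i = n := by omega
        exact hrun hb q₀ _ j (.inr ⟨e, hk⟩) hj (by omega) hrep
    refine ⟨?_, fun hb => ⟨hrun hb, hload hb⟩⟩
    by_contra hb
    by_cases hk : b.kind = reset
    · have hperm := hsub.perm_of_length_le (by omega)
      rw [hk] at hfol hperm
      have hbok : BlockOK M reset b.cells := hk ▸ h.1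
      have hm := h.2.2.2.1 hk
      have hall : ∀ d ∈ b'.cells, d.1 = free := by
        intro d hd
        have := hperm.mem_iff.2 hd
        rcases hc : b.cells with _ | ⟨c, cs⟩
        · rw [hc] at this
          cases this
        · rw [hc] at this
          simp only [relabelled, headNext, restNext, Option.toList_none, List.map_nil,
            List.nil_append, List.mem_map] at this
          obtain ⟨x, -, rfl⟩ := this
          rfl
      have hfree : freeCount b'.cells = b'.cells.length := by
        rw [freeCount, List.count_eq_length.2, List.length_map]
        intro x hx
        obtain ⟨d, hd, rfl⟩ := List.mem_map.1 hx
        exact (hall d hd).symm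
      -- After the reset there are `j + n + 1` free atoms, one more than `n` loads and `j` steps can
      -- use.
      refine (ih₂ (by omega)).2 0 n hfol hm (by omega) (by omega) fun c => ?_
      rw [Function.update_apply, Pi.zero_apply, ite_self, List.count_eq_zero]
      intro hx
      obtain ⟨d, hd, hx⟩ := List.mem_map.1 hx
      rw [hall d hd] at hx
      cases hx
    -- Any other block passes its full length on to the next one, which would exceed the bound
    -- already.
    · have := hlen' hk
      omega

/-- If the machine halts, then all blocks of words without errors are bounded. -/
theorem blocksLE_of_haltsIn {j : ℕ} (hj : HaltsIn M j (q₀, Function.update 0 c₀ n))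
    {w : List (Letter Λ C × 𝔸)} (hw : ¬ (machineDiscipline M q₀ c₀).Err n none w) :
    (machineDiscipline M q₀ c₀).BlocksLE (j + n + 1) 0 w := by
  rcases w with _ | ⟨⟨⟨t, k⟩, a⟩, w⟩
  · simp [BlockDiscipline.BlocksLE]
  simp only [BlockDiscipline.Err, not_or, not_not, not_and] at hw
  obtain ⟨hadj, -, -, hm, hw⟩ := hw
  rcases k with _ | k
  · obtain ⟨cs, bs, rfl⟩ := (exists_blocks hw).1 rfl
    obtain rfl : t = reset := hadj
    have hvalid : ValidBlocks M q₀ c₀ n (⟨reset, a, cs⟩ :: bs) := by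
      refine not_err_iff_validBlocks.1 ⟨hw, fun _ => ?_⟩
      rw [← miscount_cellsWord]
      exact hm rfl
    have hall : ∀ (bs : List (Block Λ C 𝔸)) b, ValidBlocks M q₀ c₀ n (b :: bs) →
        ∀ d ∈ b :: bs, d.cells.length ≤ j + n + 1 := by
      intro bs
      induction bs with
      | nil =>
        intro b h d hd
        rw [List.mem_singleton.1 hd]
        exact (no_large_block hj b h).1
      | cons b' bs ih =>
        intro b h d hd
        rcases List.mem_cons.1 hd with rfl | hd
        · exact (no_large_block hj _ h).1
        · exact ih b' h.of_cons d hd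
    exact blocksLE_restWord (t := reset) (cs := []) (Nat.zero_le _) (hall bs _ hvalid)
  · exact hadj.elim

end Encoding

/-! ### Infinite computations yield words with large blocks -/

section Encoding

open BlockKind CellLabel

variable {Λ C 𝔸 : Type} {M : Λ → CounterInstruction Λ C} {q₀ : Λ} {c₀ : C} {n : ℕ}

/-- The labels and atoms in the first block of some sequence of blocks. -/
def Completable (M : Λ → CounterInstruction Λ C) (q₀ : Λ) (c₀ : C) (n : ℕ)
    (K : Block Λ C 𝔸 → List (Block Λ C 𝔸) → Prop) (p : List (CellLabel C × 𝔸)) : Prop :=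
  ∃ b bs, ValidBlocks M q₀ c₀ n (b :: bs) ∧ K b bs ∧ p ⊆ b.cells

/-- Putting a block in front of a sequence of blocks. -/
theorem Completable.cons {K K' : Block Λ C 𝔸 → List (Block Λ C 𝔸) → Prop} {t : BlockKind Λ}
    {c : CellLabel C × 𝔸} {cs p : List (CellLabel C × 𝔸)} (hp : p.Perm (c :: cs))
    (hnodup : (p.map Prod.snd).Nodup) (hhead : HeadOK M t c.1) (hrest : ∀ d ∈ cs, RestOK M t d.1)
    (h : Completable M q₀ c₀ n K (relabelled M c₀ t (c :: cs)))
    (hfol : ∀ b bs, K b bs → Follows M q₀ t b.kind ∧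
      (t = reset → ¬ (machineDiscipline M q₀ c₀).Miscount n (blocksWord (b :: bs))))
    (hK : ∀ b bs, K b bs → K' ⟨t, c.2, c :: cs⟩ (b :: bs)) :
    Completable M q₀ c₀ n K' p := by
  obtain ⟨b, bs, hv, hb, hsub⟩ := h
  refine ⟨⟨t, c.2, c :: cs⟩, b :: bs, ⟨⟨hhead, hrest, ?_⟩, (hfol b bs hb).1, hsub,
    (hfol b bs hb).2, hv⟩, hK b bs hb, hp.subset⟩
  exact (hp.map Prod.snd).nodup_iff.1 hnodup

/-- A bound for the number of steps before all atoms are wasted. -/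
def weight (p : List (CellLabel C × 𝔸)) : ℕ :=
  (p.map fun d => match d.1 with
    | none => 2
    | some none => 0
    | some (some _) => 1).sum

theorem weight_perm {p p' : List (CellLabel C × 𝔸)} (h : p.Perm p') : weight p = weight p' :=
  (h.map _).sum_eq

/-- Labels and blocks are forgotten here: for the memory argument it is enough that a required atom
occurs somewhere in the continuation. -/
theorem mem_of_not_lost {D : BlockDiscipline (Letter Λ C)} {σ : Letter Λ C} {a : 𝔸}
    {w : List (Letter Λ C × 𝔸)} (h : ¬ D.Lost σ a w) : a ∈ w.map Prod.snd := by
  have hmiss : ∀ w : List (Letter Λ C × 𝔸), ¬ D.Miss σ a w → a ∈ w.map Prod.snd := by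
    intro w
    induction w with
    | nil => exact fun h => absurd trivial h
    | cons b w ih =>
      intro h
      simp only [BlockDiscipline.Miss, not_or] at h
      by_cases ha : D.mat σ b.1 ∧ b.2 = a
      · simp [ha.2]
      · exact List.mem_cons_of_mem _ (ih fun hw => h.2 ⟨h.1, ha, hw⟩)
  induction w with
  | nil => exact absurd trivial h
  | cons b w ih =>
    simp only [BlockDiscipline.Lost, not_or] at h
    by_cases hb : D.sep b.1
    · exact List.mem_cons_of_mem _ (hmiss w fun hw => h.1 ⟨hb, hw⟩)
    · exact List.mem_cons_of_mem _ (ih fun hw => h.2 ⟨hb, hw⟩)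

/-- Sequences of blocks that begin with a new round of the computation. -/
def BeginsRound (M : Λ → CounterInstruction Λ C) (q₀ : Λ) (c₀ : C) (r : ℕ) (b : Block Λ C 𝔸)
    (bs : List (Block Λ C 𝔸)) : Prop :=
  (b.kind = reset ∨ b.kind = load ∨ b.kind = fin ∨ ∃ e, b.kind = step q₀ e) ∧
    ¬ (machineDiscipline M q₀ c₀).Miscount r (blocksWord (b :: bs))

/-- All lists of free atoms of a given length begin a round. -/
def RoundsComplete (𝔸 : Type) (M : Λ → CounterInstruction Λ C) (q₀ : Λ) (c₀ : C) (n m : ℕ) : Prop :=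
  ∀ p : List (CellLabel C × 𝔸), p.length = m → (p.map Prod.snd).Nodup → (∀ d ∈ p, d.1 = free) →
    Completable M q₀ c₀ n (BeginsRound M q₀ c₀ n) p

/-- The reset drops its head `c` and frees the other `m` atoms, from which a new round can be
completed by `hm`. -/
theorem completable_reset {m : ℕ} (hm : RoundsComplete 𝔸 M q₀ c₀ n m) {c : CellLabel C × 𝔸}
    {cs : List (CellLabel C × 𝔸)} (hlen : cs.length = m) (hnodup : ((c :: cs).map Prod.snd).Nodup)
    (hfree : ∀ d ∈ c :: cs, d.1 ≠ free) :
    Completable M q₀ c₀ n (fun b _ => b = ⟨reset, c.2, c :: cs⟩) (c :: cs) := by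
  refine Completable.cons (K := BeginsRound M q₀ c₀ n) (t := reset) (List.Perm.refl _) hnodup
    (hfree c (by simp)) (fun d hd => hfree d (by simp [hd])) (hm _ ?_ ?_ ?_)
    (fun b bs hb => ⟨hb.1, fun _ => hb.2⟩) (fun _ _ _ => rfl)
  · simp [relabelled, headNext, hlen]
  · exact (snd_relabelled _ _).nodup hnodup
  · intro d hd
    simp only [relabelled, headNext, restNext, Option.toList_none, List.map_nil,
      List.nil_append, List.mem_map] at hd
    obtain ⟨x, -, rfl⟩ := hd
    rfl

variable [DecidableEq C]

theorem exists_cell {p : List (CellLabel C × 𝔸)} {l : CellLabel C}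
    (h : (p.map Prod.fst).count l ≠ 0) : ∃ a cs, p.Perm ((l, a) :: cs) := by
  classical
  obtain ⟨⟨l', a⟩, hd, rfl⟩ := List.mem_map.1 (List.count_pos_iff.1 (Nat.pos_of_ne_zero h))
  exact ⟨a, _, List.perm_cons_erase hd⟩

/-- A computation that does not halt can be encoded until the atoms are exhausted. -/
theorem completable_run {m : ℕ} (hm : RoundsComplete 𝔸 M q₀ c₀ n m) (N : ℕ) :
    ∀ (p : List (CellLabel C × 𝔸)) (q : Λ) (σ : C → ℕ), weight p = N → p.length = m + 1 →
      (p.map Prod.snd).Nodup → Represents p σ → (∀ j, ¬ HaltsIn M j (q, σ)) →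
      Completable M q₀ c₀ n (fun b _ => b.kind = reset ∨ ∃ e, b.kind = step q e) p := by
  -- Every step lowers the weight: a free atom (2) becomes a counter atom (1) or waste (0), or a
  -- counter atom becomes waste.
  induction N using Nat.strong_induction_on with
  | _ N ih =>
    intro p q σ hN hlen hnodup hσ hhalt
    have hcount : ∀ {l : CellLabel C} {a : 𝔸} {cs : List (CellLabel C × 𝔸)},
        p.Perm ((l, a) :: cs) → ∀ x, (p.map Prod.fst).count x = (l :: cs.map Prod.fst).count x :=
      fun hp x => (hp.map Prod.fst).count_eq x
    have hnext : ∀ (e : Bool) (l l' : CellLabel C) (a : 𝔸) (cs : List (CellLabel C × 𝔸)) (τ : C → ℕ),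
        p.Perm ((l, a) :: cs) → HeadOK M (step q e) l → (∀ d ∈ cs, RestOK M (step q e) d.1) →
        headNext M c₀ (step q e) = some l' → (M q).exec σ = some (nextLocation M q e, τ) →
        Represents ((l', a) :: cs) τ → weight ((l', a) :: cs) < N →
        Completable M q₀ c₀ n (fun b _ => b.kind = reset ∨ ∃ e, b.kind = step q e) p := by
      intro e l l' a cs τ hp hhead hrest hl' hex hrep hw
      refine Completable.cons (t := step q e) hp hnodup hhead hrest ?_ (fun b bs hb => ⟨hb, by simp⟩)
        (fun b bs _ => .inr ⟨e, rfl⟩)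
      have hrel : relabelled M c₀ (step q e) ((l, a) :: cs) = (l', a) :: cs := by
        simp [relabelled, hl', restNext]
      rw [hrel]
      refine ih _ hw _ _ τ rfl ?_ ?_ hrep fun j hj => hhalt (j + 1) (.step hex hj)
      · rw [← hlen, hp.length_eq]
        rfl
      · exact (hp.map Prod.snd).nodup_iff.1 hnodup
    -- Without free atoms the round is ended by a reset, whatever the next instruction is.
    by_cases hf : (p.map Prod.fst).count free = 0
    · have hreset : Completable M q₀ c₀ n (fun b _ => b.kind = reset ∨ ∃ e, b.kind = step q e) p := by
        rcases p with _ | ⟨c, cs⟩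
        · simp at hlen
        · obtain ⟨b, bs, hv, rfl, hsub⟩ := completable_reset hm (by simpa using hlen) hnodup
            (fun d hd h => List.count_eq_zero.1 hf (List.mem_map.2 ⟨d, hd, h⟩))
          exact ⟨_, bs, hv, .inl rfl, hsub⟩
      exact hreset
    · obtain ⟨a, cs, hp⟩ := exists_cell hf
      have hw := weight_perm hp
      cases hM : M q with
      | halt => exact absurd (.halt (by simp [hM, CounterInstruction.exec])) (hhalt 0)
      | nop r =>
        refine hnext false free waste a cs σ hp ?_ ?_ ?_ ?_ ?_ ?_
        · simp [HeadOK, hM]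
        · simp [RestOK, hM]
        · simp [headNext, hM]
        · simp [hM, CounterInstruction.exec, nextLocation]
        · intro c
          rw [← hσ c, hcount hp]
          simp
        · rw [← hN, hw]
          simp [weight]
      | inc c r =>
        refine hnext false free (ctr c) a cs (Function.update σ c (σ c + 1)) hp ?_ ?_ ?_ ?_ ?_ ?_
        · simp [HeadOK, hM]
        · simp [RestOK, hM]
        · simp [headNext, hM]
        · simp [hM, CounterInstruction.exec, nextLocation]
        · intro c'
          have := hσ c'
          rw [hcount hp] at this
          by_cases hc : c' = c
          · subst hc
            simpa using this
          · simpa [hc, Ne.symm hc] using this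
        · rw [← hN, hw]
          simp [weight]
      | dec c r s =>
        by_cases h0 : σ c = 0
        · refine hnext false free waste a cs σ hp ?_ ?_ ?_ ?_ ?_ ?_
          · simp [HeadOK, hM]
          · intro d hd
            simp only [RestOK, hM, forall_const]
            intro hdc
            have := hσ c
            rw [h0, hcount hp] at this
            exact List.count_eq_zero.1 this (List.mem_cons_of_mem _ (List.mem_map.2 ⟨d, hd, hdc⟩))
          · simp [headNext, hM]
          · simp [hM, CounterInstruction.exec, nextLocation, h0]
          · intro c
            rw [← hσ c, hcount hp]
            simp
          · rw [← hN, hw]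
            simp [weight]
        · obtain ⟨a, cs, hp⟩ := exists_cell (l := ctr c) (p := p) (by rw [hσ c]; exact h0)
          have hw := weight_perm hp
          refine hnext true (ctr c) waste a cs (Function.update σ c (σ c - 1)) hp ?_ ?_ ?_ ?_ ?_ ?_
          · simp [HeadOK, hM]
          · simp [RestOK, hM]
          · simp [headNext, hM]
          · simp [hM, CounterInstruction.exec, nextLocation, h0]
          · intro c'
            have := hσ c'
            rw [hcount hp] at this
            by_cases hc : c' = c
            · subst hc
              simp at this ⊢
              omega
            · simpa [hc, Ne.symm hc] using this
          · rw [← hN, hw]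
            simp [weight]

/-- Induction on the number `r` of loads still to be done. If the free atoms run out earlier, the
round is cut short by a reset. -/
theorem completable_load {m : ℕ} (hm : RoundsComplete 𝔸 M q₀ c₀ n m)
    (hhalt : ∀ j, ¬ HaltsIn M j (q₀, Function.update 0 c₀ n)) (r : ℕ) :
    ∀ (p : List (CellLabel C × 𝔸)) (i : ℕ), i + r = n → p.length = m + 1 →
      (p.map Prod.snd).Nodup → Represents p (Function.update 0 c₀ i) →
      Completable M q₀ c₀ n (BeginsRound M q₀ c₀ r) p := by
  induction r with
  | zero =>
    intro p i hi hlen hnodup hrep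
    obtain rfl : i = n := hi
    obtain ⟨b, bs, hv, hk, hsub⟩ := completable_run hm _ p q₀ _ rfl hlen hnodup hrep hhalt
    refine ⟨b, bs, hv, ⟨?_, ?_⟩, hsub⟩
    · rcases hk with hk | hk
      · exact .inl hk
      · exact .inr (.inr (.inr hk))
    · rw [miscount_blocksWord_cons]
      rcases hk with hk | ⟨e, hk⟩ <;> simp [hk]
  | succ r ih =>
    intro p i hi hlen hnodup hrep
    by_cases hf : (p.map Prod.fst).count free = 0
    · rcases p with _ | ⟨c, cs⟩
      · simp at hlen
      · obtain ⟨b, bs, hv, rfl, hsub⟩ := completable_reset hm (by simpa using hlen) hnodup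
          (fun d hd h => List.count_eq_zero.1 hf (List.mem_map.2 ⟨d, hd, h⟩))
        refine ⟨_, bs, hv, ⟨.inl rfl, ?_⟩, hsub⟩
        rw [miscount_blocksWord_cons]
        simp
    · obtain ⟨a, cs, hp⟩ := exists_cell hf
      refine Completable.cons (K := BeginsRound M q₀ c₀ r) (t := load) hp hnodup rfl
        (fun _ _ => trivial) ?_ (fun b bs hb => ⟨hb.1, by simp⟩) ?_
      · have hrel : relabelled M c₀ load ((free, a) :: cs) = (ctr c₀, a) :: cs := by
          simp [relabelled, headNext, restNext]
        rw [hrel]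
        refine ih _ (i + 1) (by omega) ?_ ?_ fun c => ?_
        · rw [← hlen, hp.length_eq]
          rfl
        · exact (hp.map Prod.snd).nodup_iff.1 hnodup
        · have := hrep c
          rw [(hp.map Prod.fst).count_eq] at this
          by_cases hc : c = c₀
          · subst hc
            simpa using this
          · simpa [hc, Ne.symm hc] using this
      · intro b bs hb
        refine ⟨.inr (.inl rfl), ?_⟩
        rw [miscount_blocksWord_cons]
        simpa using hb.2

/-- A round begun with `m + 1` atoms ends with a reset and leaves `m` atoms for the next one; with
no atoms left, the word ends with an empty `fin` block. -/
theorem roundsComplete [Nonempty 𝔸] (hhalt : ∀ j, ¬ HaltsIn M j (q₀, Function.update 0 c₀ n)) (m : ℕ) :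
    RoundsComplete 𝔸 M q₀ c₀ n m := by
  induction m with
  | zero =>
    intro p hp _ _
    obtain rfl := List.length_eq_zero_iff.1 hp
    refine ⟨⟨fin, Classical.arbitrary 𝔸, []⟩, [], ⟨rfl, rfl⟩, ⟨.inr (.inr (.inl rfl)), ?_⟩, by simp⟩
    rw [miscount_blocksWord_cons]
    simp
  | succ m ih =>
    intro p hlen hnodup hfree
    refine completable_load ih hhalt n p 0 (by omega) hlen hnodup fun c => ?_
    rw [Function.update_apply, Pi.zero_apply, ite_self, List.count_eq_zero]
    intro hx
    obtain ⟨d, hd, hx⟩ := List.mem_map.1 hx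
    rw [hfree d hd] at hx
    cases hx

/-- If the machine does not halt, then arbitrarily many atoms have to be remembered. -/
theorem not_isDRALanguage_of_not_haltsIn [Infinite 𝔸]
    (hhalt : ∀ j, ¬ HaltsIn M j (q₀, Function.update 0 c₀ n)) {L : Language (Letter Λ C × 𝔸)}
    (hL : ∀ w, w ∈ L ↔ (machineDiscipline M q₀ c₀).Err n none w) : ¬ IsDRALanguage L := by
  classical
  refine not_isDRALanguage_of_memory fun k => ?_
  -- One atom serves as the head, which the reset drops; the other `k + 1` must recur in the next
  -- block.
  obtain ⟨F, hF⟩ := Infinite.exists_subset_card_eq 𝔸 (k + 2)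
  obtain ⟨a₀, ha₀⟩ := Finset.card_pos.1 (by omega : 0 < F.card)
  let cs : List (CellLabel C × 𝔸) := (F.erase a₀).toList.map fun a => (waste, a)
  have hcs : cs.map Prod.snd = (F.erase a₀).toList := by simp [cs, Function.comp_def]
  have hwaste : ∀ d ∈ cs, d.1 = waste := by
    intro d hd
    obtain ⟨a, -, rfl⟩ := List.mem_map.1 hd
    rfl
  obtain ⟨b, bs, hv, rfl, -⟩ := completable_reset (roundsComplete hhalt cs.length)
    (c := (waste, a₀)) (cs := cs) rfl (by simp [hcs, Finset.nodup_toList])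
    (by
      intro d hd h
      rcases List.mem_cons.1 hd with rfl | hd
      · cases h
      · rw [hwaste d hd] at h
        cases h)
  refine ⟨blocksWord [⟨reset, a₀, (waste, a₀) :: cs⟩], blocksWord bs, F.erase a₀,
    ((blocksWord bs).map Prod.snd).toFinset, ?_, ?_, ?_⟩
  · rw [Finset.card_erase_of_mem ha₀, hF]
    omega
  · rw [hL]
    have := not_err_iff_validBlocks.2 hv
    simp only [blocksWord, List.append_nil, List.cons_append, BlockDiscipline.Err, not_or,
      miscount_cellsWord]
    refine ⟨?_, ?_, ?_, ?_, this.1⟩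
    · simp [machineDiscipline, Adjacent]
    · simp [machineDiscipline]
    · simp [machineDiscipline, nextLabel]
    · rintro ⟨-, h⟩
      exact this.2 rfl h
  · intro a ha b hb
    rw [hL]
    by_contra hne
    have hbd : AtBoundary ((blocksWord bs).map (Prod.map id (Equiv.swap a b))) := by
      cases bs <;> simp [AtBoundary, blocksWord]
    simp only [blocksWord, List.append_nil, List.cons_append, BlockDiscipline.Err, not_or] at hne
    have hlost := ((not_err_cellsWord hbd).1 hne.2.2.2.2).2.2.1 (waste, a)
      (List.mem_map.2 ⟨a, by simpa using ha, rfl⟩)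
    have hmem := mem_of_not_lost hlost
    rw [List.map_map, List.mem_map] at hmem
    obtain ⟨x, hx, hxa⟩ := hmem
    simp only [Function.comp_apply, Prod.map_snd] at hxa
    -- If `a` occurs in the swapped continuation, then `b` occurs in the original one, which the
    -- choice of `b` excludes.
    rw [Equiv.swap_apply_eq_iff, Equiv.swap_apply_left] at hxa
    exact hb (by rw [← hxa]; exact List.mem_toFinset.2 (List.mem_map.2 ⟨x, hx, rfl⟩))

end Encoding

/-! ### Computability of the reduction -/

namespace BlockDiscipline

open RegisterAutomaton ErrorLocation

/-- Renaming the locations of a rule. -/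
def _root_.TransitionRule.mapLocation {X S Q Q' : Type} (f : Q → Q') (r : TransitionRule X S Q) :
    TransitionRule X S Q' :=
  ⟨f r.src, r.sym, r.guard, r.upd, f r.dst⟩

theorem map_listIf {α β : Type} (f : α → β) (p : Prop) (x : α) :
    (listIf p x).map f = listIf p (f x) := by
  by_cases h : p <;> simp [listIf, h]

variable {S : Type} {k : ℕ} (f : ErrorLocation S ≃ Fin k)

/-- Inserting the values of the parameters. -/
def insertCounts {n : ℕ} (a b : Fin (n + 1)) :
    ErrorLocation S ⊕ Bool → ErrorLocation S ⊕ Fin (n + 1) :=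
  Sum.map id fun e => if e then a else b

/-- The numbering of the locations. -/
def locationEquiv (n : ℕ) : ErrorLocation S ⊕ Fin (n + 1) ≃ Fin (k + (n + 1)) :=
  (Equiv.sumCongr f (Equiv.refl _)).trans finSumFinEquiv

/-- The number of a location as an affine function of the parameters. -/
def affineCode (q : ErrorLocation S ⊕ Bool) : ℕ × ℕ × ℕ :=
  q.elim (fun p => (f p, 0, 0)) fun b => if b then (k, 1, 0) else (k, 0, 1)

/-- Evaluation of affine functions. -/
def evalAffine (c : ℕ × ℕ × ℕ) (t : ℕ × ℕ) : ℕ := c.1 + c.2.1 * t.1 + c.2.2 * t.2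

theorem locationEquiv_insertCounts {n : ℕ} (a b : Fin (n + 1)) (q : ErrorLocation S ⊕ Bool) :
    (locationEquiv f n (insertCounts a b q) : ℕ) = evalAffine (affineCode f q) (a, b) := by
  rcases q with p | _ | _ <;> simp [locationEquiv, insertCounts, affineCode, evalAffine]

variable (D : BlockDiscipline S) [Fintype S]

theorem map_startRules {Q Q' : Type} (f : Q → Q') (i : ErrorLocation S → Q) (q : Q) :
    (D.startRules i q).map (.mapLocation f) = D.startRules (f ∘ i) (f q) := by
  simp [startRules, List.map_flatMap, map_listIf, move, TransitionRule.mapLocation]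

theorem map_zeroRules {Q Q' : Type} (f : Q → Q') (s q : Q) :
    (D.zeroRules s q).map (.mapLocation f) = D.zeroRules (f s) (f q) := by
  simp [zeroRules, List.map_flatMap, map_listIf, move, TransitionRule.mapLocation]

theorem map_succRules {Q Q' : Type} (f : Q → Q') (s q q' : Q) :
    (D.succRules s q q').map (.mapLocation f) = D.succRules (f s) (f q) (f q') := by
  simp [succRules, List.map_flatMap, map_listIf, move, TransitionRule.mapLocation]

/-- The rules in which only the final and the initial value of the count are parameters. -/
noncomputable def baseRules : List (TransitionRule (Fin 1) S (ErrorLocation S ⊕ Bool)) :=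
  D.fixedRules.map (.mapLocation .inl) ++ D.startRules .inl (.inr true) ++
    D.zeroRules (.inl sink) (.inr false)

theorem rules_errorAutomaton (n : ℕ) : (D.errorAutomaton n).rules =
    D.baseRules.map (.mapLocation (insertCounts (Fin.last n) 0)) ++
    (List.finRange n).flatMap fun i => (D.succRules (.inl sink) (.inr true) (.inr false)).map
      (.mapLocation (insertCounts i.succ i.castSucc)) := by
  simp only [baseRules, List.map_append, map_startRules, map_zeroRules, map_succRules, List.map_map]
  rfl

variable {m : ℕ} (e : S ≃ Fin m)

/-- The automaton detecting violations, with numbers as symbols and locations. -/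
noncomputable def numberedAutomaton (n : ℕ) :
    RegisterAutomaton (Fin 1) (Fin m) (Fin (k + (n + 1))) :=
  (D.errorAutomaton n).relabel e (locationEquiv f n)

/-- Numbers for the components of a rule with parameters. -/
def ruleCode (r : TransitionRule (Fin 1) S (ErrorLocation S ⊕ Bool)) :
    (ℕ × ℕ × ℕ) × (ℕ × ℕ × List Bool) × (ℕ × ℕ × ℕ) :=
  (affineCode f r.src, ((e r.sym).val, r.guard.code, List.ofFn r.upd), affineCode f r.dst)

/-- Inserting the values of the parameters into a numbered rule. -/
def evalRuleCode (c : (ℕ × ℕ × ℕ) × (ℕ × ℕ × List Bool) × (ℕ × ℕ × ℕ)) (t : ℕ × ℕ) :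
    ℕ × ℕ × ℕ × List Bool × ℕ :=
  (evalAffine c.1 t, c.2.1.1, c.2.1.2.1, c.2.1.2.2, evalAffine c.2.2 t)

theorem primrec_evalAffine : Primrec₂ evalAffine := by
  have h : Primrec fun p : (ℕ × ℕ × ℕ) × (ℕ × ℕ) => p.1.1 + p.1.2.1 * p.2.1 + p.1.2.2 * p.2.2 :=
    Primrec.nat_add.comp (Primrec.nat_add.comp (Primrec.fst.comp Primrec.fst)
      (Primrec.nat_mul.comp (Primrec.fst.comp (Primrec.snd.comp Primrec.fst))
        (Primrec.fst.comp Primrec.snd)))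
      (Primrec.nat_mul.comp (Primrec.snd.comp (Primrec.snd.comp Primrec.fst))
        (Primrec.snd.comp Primrec.snd))
  exact h.to₂

theorem primrec_evalRuleCode : Primrec₂ evalRuleCode := by
  have h : Primrec fun p : ((ℕ × ℕ × ℕ) × (ℕ × ℕ × List Bool) × (ℕ × ℕ × ℕ)) × (ℕ × ℕ) =>
      (evalAffine p.1.1 p.2, p.1.2.1.1, p.1.2.1.2.1, p.1.2.1.2.2, evalAffine p.1.2.2 p.2) := by
    have h1 := Primrec.fst (α := (ℕ × ℕ × ℕ) × (ℕ × ℕ × List Bool) × (ℕ × ℕ × ℕ)) (β := ℕ × ℕ)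
    have h2 := Primrec.snd (α := (ℕ × ℕ × ℕ) × (ℕ × ℕ × List Bool) × (ℕ × ℕ × ℕ)) (β := ℕ × ℕ)
    have h3 := Primrec.fst.comp (Primrec.snd.comp h1)
    exact (primrec_evalAffine.comp (Primrec.fst.comp h1) h2).pair
      ((Primrec.fst.comp h3).pair ((Primrec.fst.comp (Primrec.snd.comp h3)).pair
        ((Primrec.snd.comp (Primrec.snd.comp h3)).pair
          (primrec_evalAffine.comp (Primrec.snd.comp (Primrec.snd.comp h1)) h2))))
  exact h.to₂

theorem flatMap_finRange {α : Type} (n : ℕ) (g : ℕ → List α) :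
    ((List.finRange n).flatMap fun i : Fin n => g i) = (List.range n).flatMap g := by
  rw [← List.map_coe_finRange_eq_range, List.flatMap_map]

/-- The lists of rules with parameters do not depend on `n`; although they are obtained by choice,
they are constants of the reduction. Location numbers are affine in the parameters, which are `(n,
0)` for the start and the end of the count and `(i + 1, i)` for a single countdown, so the code is
visibly primitive recursive in `n`. -/
theorem code_numberedAutomaton (n : ℕ) : (D.numberedAutomaton f e n).code =
    Encodable.encode (1, m, k + (n + 1), [(f (scan none) : ℕ)], D.fixedFinal.map (fun q => (f q : ℕ)),
      (D.baseRules.map (ruleCode f e)).map (fun c => evalRuleCode c (n, 0)) ++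
      (List.range n).flatMap fun i =>
        ((D.succRules (.inl sink) (.inr true) (.inr false)).map (ruleCode f e)).map
          fun c => evalRuleCode c (i + 1, i)) := by
  refine congrArg Encodable.encode (Prod.ext rfl (Prod.ext rfl (Prod.ext rfl (Prod.ext ?_
    (Prod.ext ?_ ?_)))))
  · simp [numberedAutomaton, relabel, errorAutomaton, locationEquiv]
  · simp only [numberedAutomaton, relabel, errorAutomaton, List.map_map]
    refine List.map_congr_left fun q _ => ?_
    simp [locationEquiv]
  · simp only [numberedAutomaton, relabel, rules_errorAutomaton, List.map_append, List.map_map,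
      List.map_flatMap]
    rw [← flatMap_finRange]
    congr 1
    · refine List.map_congr_left fun r _ => ?_
      simp [TransitionRule.mapLocation, ruleCode, evalRuleCode, locationEquiv_insertCounts]
    · refine List.flatMap_congr fun i _ => List.map_congr_left fun r _ => ?_
      simp [TransitionRule.mapLocation, ruleCode, evalRuleCode, locationEquiv_insertCounts]

theorem computable_code_numberedAutomaton :
    Computable fun n => (D.numberedAutomaton f e n).code := by
  refine Primrec.to_comp (Primrec.of_eq ?_ fun n => (code_numberedAutomaton f D e n).symm)
  refine Primrec.encode.comp ((Primrec.const 1).pair ((Primrec.const m).pair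
    ((Primrec.nat_add.comp (Primrec.const k) Primrec.succ).pair ((Primrec.const _).pair
      ((Primrec.const _).pair (Primrec.list_append.comp ?_ ?_))))))
  · exact Primrec.list_map (Primrec.const _) (primrec_evalRuleCode.comp₂ Primrec₂.right
      ((Primrec.id.pair (Primrec.const 0)).comp₂ Primrec₂.left))
  · have h : Primrec fun p : ℕ × ℕ =>
        ((D.succRules (.inl sink) (.inr true) (.inr false)).map (ruleCode f e)).map
          fun c => evalRuleCode c (p.2 + 1, p.2) :=
      Primrec.list_map (Primrec.const _) (primrec_evalRuleCode.comp₂ Primrec₂.right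
        (((Primrec.succ.pair Primrec.id).comp Primrec.snd).comp₂ Primrec₂.left))
    exact Primrec.list_flatMap Primrec.list_range h.to₂

end BlockDiscipline

theorem theorem4 (𝔸 : Type) [Countable 𝔸] [Infinite 𝔸] :
    ¬ ∃ D : ℕ → Prop, ComputablePred D ∧
      ∀ (m n : ℕ) (A : RegisterAutomaton (Fin 1) (Fin m) (Fin n)),
        D A.code ↔ IsDRALanguage (A.language 𝔸) := by
  rintro ⟨P, hP, hcorrect⟩
  obtain ⟨Λ, C, hΛ, hC, hdec, M, q₀, c₀, hM⟩ := exists_undecidable_counterMachine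
  have := Fintype.ofFinite (Letter Λ C)
  let D := machineDiscipline M q₀ c₀
  let e := Finite.equivFin (Letter Λ C)
  let f := Finite.equivFin (ErrorLocation (Letter Λ C))
  refine hM ?_
  -- The numberings `e` and `f` do not depend on `n`, and renaming the symbols along the bijection
  -- `e` preserves being recognised by a deterministic automaton in both directions.
  have key : ∀ n, P (D.numberedAutomaton f e n).code ↔
      ∃ j, HaltsIn M j (q₀, Function.update 0 c₀ n) := by
    intro n
    have hmem : ∀ w : List (Letter Λ C × 𝔸), w.map (Prod.map e id) ∈
        (D.numberedAutomaton f e n).language 𝔸 ↔ w ∈ (D.errorAutomaton n).language 𝔸 :=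
      fun w => RegisterAutomaton.mem_language_relabel e.injective (Equiv.injective _)
    rw [hcorrect]
    constructor
    · intro h
      by_contra! hhalt
      refine not_isDRALanguage_of_not_haltsIn hhalt
        (fun w => BlockDiscipline.mem_language_errorAutomaton) (h.of_relabel e.symm fun w => ?_)
      rw [← hmem]
      simp [List.map_map, Function.comp_def, Prod.map]
    · rintro ⟨j, hj⟩
      exact (BlockDiscipline.isDRALanguage_errorAutomaton (not_sep_of_need M q₀ c₀) _
        fun w hw => blocksLE_of_haltsIn hj hw).of_relabel e hmem
  obtain ⟨g, hg, hgP⟩ := ComputablePred.computable_iff.1 hP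
  refine ComputablePred.computable_iff.2 ⟨fun n => g (D.numberedAutomaton f e n).code,
    hg.comp (D.computable_code_numberedAutomaton f e), ?_⟩
  funext n
  rw [← key n, hgP]
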